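/- Let $p=3$. For $n\ge 0$ let $\mathcal P_n$ be the set of partitions of $n$; for $m\ge 0$ let $\mathcal P_n(\le m)=\{\lambda\in\mathcal P_n:\lambda_1\ge n-m\}$, and let $\mathcal P_n^{3\text{-reg}}(\le m)$ be its subset of $3$-regular partitions (every part occurs at most twice). For a finite weakly decreasing sequence of positive integers $t=(t_1,t_2,\dots)$ with sum $|t|$, write $(t)=[n-|t|,t_1,t_2,\dots]\in\mathcal P_n$. The node in row $a$ and column $b$ has residue $b-a$ modulo $3$. Let $\mathcal F_q$ be the free $\mathbb Z[q,q^{-1}]$-module on all partitions of all $n\ge 0$, with the operators $$F_i^{(k)}\lambda=\sum_{X}q^{\sum_{x\in X}(a_i(\lambda\cup X,x)-r_i(\lambda,x))}\,(\lambda\cup X)\qquad(i\in\mathbb Z/3,\ k\ge 0),$$ where $X$ runs through the $k$-element sets of addable nodes of $\lambda$ of residue $i$, and $a_i(\nu,x)$, $r_i(\nu,x)$ are the numbers of addable, respectively removable, nodes of $\nu$ of residue $i$ strictly to the right of $x$. Let $\mathcal L$ be the submodule generated by the empty partition $[\,]$ under all $F_i^{(k)}$. The bar involution of $\mathcal L$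 is the $\mathbb Z$-linear map that fixes the image of $[\,]$ under every product of operators $F_i^{(k)}$ and satisfies $\overline{q\,x}=q^{-1}\bar x$. The global crystal basis is the $\mathbb Z[q,q^{-1}]$-basis $\{B^\mu\}$ of $\mathcal L$, indexed by the $3$-regular partitions, with $\overline{B^\mu}=B^\mu$ and $B^\mu-\mu$ having all its coefficients in $q\mathbb Z[q]$; write $B^\mu=\sum_\lambda b_{\lambda,\mu}(q)\,\lambda$. Let $\mathcal F_q(\le 4)$ be the quotient of $\mathcal F_q$ by the span of all partitions $\lambda$ of all $n$ with $\lambda_1<n-4$, let $\equiv$ denote equality in this quotient, and let $\mathcal D_n^q(\le 4)=(b_{\lambda,\mu}(q))$, with $\lambda\in\mathcal P_n(\le4)$ and $\mu\in\mathcal P_n^{3\text{-reg}}(\le 4)$, both in reversed lexicographical order. Let $\delta_i=1$ if $n\equiv i\pmod 3$, and $\delta_i=0$ otherwise. Consider the following table, with zero entries written as dots. $$\begin{array}{l|cccccccccc} & () & (1) & (2) & (1^2) & (3) & (2,1) & (4) & (3,1) & (2^2) & (2,1^2)\\ \hline () & 1&.&.&.&.&.&.&.&.&.\\ (1) & q\delta_0&1&.&.&.&.&.&.&.&.\\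 (2) & q\delta_1&q\delta_2&1&.&.&.&.&.&.&.\\ (1^2) & .&q\delta_0&.&1&.&.&.&.&.&.\\ (3) & .&q\delta_0&q\delta_1&.&1&.&.&.&.&.\\ (2,1) & q&q^2\delta_0&q^2\delta_1&q\delta_0&q&1&.&.&.&.\\ (1^3) & .&.&.&q^2\delta_0&.&q&.&.&.&.\\ (4) & .&.&q\delta_2&.&q\delta_0&.&1&.&.&.\\ (3,1) & .&.&.&q\delta_1&q^2\delta_2&q\delta_2&.&1&.&.\\ (2^2) & q^2\delta_0&q&q^2\delta_2&.&q^2\delta_0&q\delta_0&q&.&1&.\\ (2,1^2) & q\delta_1&.&.&.&q\delta_1&q^2\delta_1&.&.&.&1\\ (1^4) & .&.&.&.&.&q^2\delta_0&.&.&q&. \end{array}$$ 1. For $\bar\mu=(),(1),(2),(1^2),(3),(2,1),(4),(3,1),(2^2),(2,1^2)$ let $n\ge 7,7,6,5,7,6,8,7,7,6$, respectively. Then $\mu=(\bar\mu)\in\mathcal P_n$ is $3$-regular, and $$B^\mu\equiv\sum_{\lambda}d_{\lambda,\mu}\,\lambda,$$ where $d_{\lambda,\mu}$ is the entry of the table in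 row $\lambda$ and column $\mu$. In particular $B^\mu$ in $\mathcal F_q(\le 4)$ depends, in this notation, only on $\bar\mu$ and on $n$ modulo $3$. Moreover the right hand side is the unique element of the image of $\mathcal L$ in $\mathcal F_q(\le 4)$ that is fixed by the induced bar involution and is congruent to $\mu$ modulo the $q\mathbb Z[q]$-span of the partitions. 2. For $n\ge 8$ the rows and the columns of the table list $\mathcal P_n(\le 4)$ and $\mathcal P_n^{3\text{-reg}}(\le 4)$, respectively, in reversed lexicographical order, and $\mathcal D_n^q(\le 4)$ is the matrix given by the table. In particular its entries depend only on $n$ modulo $3$. -/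

import Mathlib

open scoped LaurentPolynomial

noncomputable section

namespace LLT

/-! ### Partitions, nodes and residues

A partition is a `YoungDiagram`; rows and columns are numbered from `0`. -/

/-- The `p`-residue of the node `x` in row `x.1` and column `x.2`. -/
def residue (p : ℕ) (x : ℕ × ℕ) : ZMod p := (x.2 : ZMod p) - (x.1 : ZMod p)

/-- The addable `i`-nodes of `l`. -/
def addable (p : ℕ) (i : ZMod p) (l : YoungDiagram) : Finset (ℕ × ℕ) :=
  ((Finset.range (l.colLen 0 + 1)).image fun a => (a, l.rowLen a)).filter fun x =>
    (x.1 = 0 ∨ l.rowLen x.1 < l.rowLen (x.1 - 1)) ∧ residue p x = i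

/-- The removable `i`-nodes of `l`. -/
def removable (p : ℕ) (i : ZMod p) (l : YoungDiagram) : Finset (ℕ × ℕ) :=
  ((Finset.range (l.colLen 0)).image fun a => (a, l.rowLen a - 1)).filter fun x =>
    l.rowLen (x.1 + 1) < l.rowLen x.1 ∧ residue p x = i

/-- Adding a set of addable nodes to a Young diagram gives a Young diagram. -/
theorem isLowerSet_union {p : ℕ} {i : ZMod p} {l : YoungDiagram} {X : Finset (ℕ × ℕ)}
    (hX : X ⊆ addable p i l) : IsLowerSet ((l.cells ∪ X : Finset (ℕ × ℕ)) : Set (ℕ × ℕ)) := by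
  rintro ⟨a, b⟩ ⟨a', b'⟩ ⟨ha, hb⟩ hx
  simp only [Finset.coe_union, Set.mem_union, Finset.mem_coe] at hx ⊢
  simp only at ha hb
  rcases hx with hx | hx
  · exact Or.inl (l.isLowerSet (Prod.mk_le_mk.2 ⟨ha, hb⟩) hx)
  · have h := hX hx
    simp only [addable, Finset.mem_filter, Finset.mem_image, Prod.mk.injEq] at h
    obtain ⟨⟨c, -, rfl, rfl⟩, h, -⟩ := h
    rcases Nat.lt_or_ge a' c with hlt | hge
    · left
      rw [YoungDiagram.mem_cells, YoungDiagram.mem_iff_lt_rowLen]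
      have h1 : l.rowLen c < l.rowLen (c - 1) := h.resolve_left (by omega)
      have h2 : l.rowLen (c - 1) ≤ l.rowLen a' := l.rowLen_anti _ _ (by omega)
      omega
    · obtain rfl : a' = c := le_antisymm ha hge
      rcases Nat.lt_or_ge b' (l.rowLen a') with hlt | hge
      · left
        rwa [YoungDiagram.mem_cells, YoungDiagram.mem_iff_lt_rowLen]
      · obtain rfl : b' = l.rowLen a' := le_antisymm hb hge
        exact Or.inr hx

open Classical in
/-- The partition `l ∪ X`, for a set `X` of addable nodes of `l` (and `l` if `l ∪ X` is not a
Young diagram, which does not happen below, see `addNodes_cells`). -/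
def addNodes (l : YoungDiagram) (X : Finset (ℕ × ℕ)) : YoungDiagram :=
  if h : IsLowerSet ((l.cells ∪ X : Finset (ℕ × ℕ)) : Set (ℕ × ℕ)) then ⟨l.cells ∪ X, h⟩ else l

theorem addNodes_cells {p : ℕ} {i : ZMod p} {l : YoungDiagram} {X : Finset (ℕ × ℕ)}
    (hX : X ⊆ addable p i l) : (addNodes l X).cells = l.cells ∪ X := by
  simp only [addNodes, dif_pos (isLowerSet_union hX)]

/-- A partition is `p`-regular if every part occurs less than `p` times. -/
def IsRegular (p : ℕ) (l : YoungDiagram) : Prop := ∀ a ∈ l.rowLens, l.rowLens.count a < p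

/-- The partitions of `n` whose largest part is at least `n - m`. -/
def ptn (n m : ℕ) : Set YoungDiagram := {l | l.card = n ∧ n ≤ l.rowLen 0 + m}

open Classical in
/-- The partition `(t) = [n - |t|, t₁, t₂, …]` of `n` with tail `t`
(the empty partition if this is not a weakly decreasing sequence). -/
def withTail (n : ℕ) (t : List ℕ) : YoungDiagram :=
  if h : ((n - t.sum) :: t).SortedGE then YoungDiagram.ofRowLens ((n - t.sum) :: t) h else ⊥

/-! ### The Fock space and its truncation -/

/-- The Fock space: the free `ℤ[q, q⁻¹]`-module on all partitions of all `n ≥ 0`. -/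
abbrev Fock : Type := YoungDiagram →₀ ℤ[T;T⁻¹]

/-- The indeterminate `q`. -/
def q : ℤ[T;T⁻¹] := LaurentPolynomial.T 1

/-- A partition as an element of the Fock space. -/
def vec (l : YoungDiagram) : Fock := Finsupp.single l 1

/-- The exponent of `q` at `l ∪ X` in the image of `l` under the divided power operator: the sum
over `x ∈ X` of the number of addable `i`-nodes of `l ∪ X` strictly to the right of `x` minus the
number of removable `i`-nodes of `l` strictly to the right of `x`. -/
def expo (p : ℕ) (i : ZMod p) (l : YoungDiagram) (X : Finset (ℕ × ℕ)) : ℤ :=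
  ∑ x ∈ X, ((((addable p i (addNodes l X)).filter fun y => x.2 < y.2).card : ℤ)
    - (((removable p i l).filter fun y => x.2 < y.2).card : ℤ))

/-- The divided power operator `F_i^{(k)}`. -/
def F (p : ℕ) (i : ZMod p) (k : ℕ) : Fock →ₗ[ℤ[T;T⁻¹]] Fock :=
  Finsupp.linearCombination ℤ[T;T⁻¹] fun l =>
    ∑ X ∈ (addable p i l).powersetCard k,
      (LaurentPolynomial.T (expo p i l X) : ℤ[T;T⁻¹]) • vec (addNodes l X)

/-- The result of applying a word in the divided power operators, from left to right, to the
empty partition. -/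
def applyWord (p : ℕ) (w : List (ZMod p × ℕ)) : Fock :=
  w.foldl (fun v g => F p g.1 g.2 v) (vec ⊥)

/-- `ℤ[q, q⁻¹]`-linear combinations of words in the divided power operators, that is, elements
of the free `ℤ[q, q⁻¹]`-algebra on the symbols `F_i^{(k)}`. -/
abbrev Words (p : ℕ) : Type := List (ZMod p × ℕ) →₀ ℤ[T;T⁻¹]

/-- The map `u ↦ [] · u`. -/
def act (p : ℕ) : Words p →ₗ[ℤ[T;T⁻¹]] Fock :=
  Finsupp.linearCombination ℤ[T;T⁻¹] (applyWord p)

/-- The bar involution on words: it sends `q` to `q⁻¹` and fixes every `F_i^{(k)}`. -/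
def bar {p : ℕ} (u : Words p) : Words p :=
  u.mapRange LaurentPolynomial.invert (map_zero _)

/-- The submodule generated by the empty partition under the divided power operators. -/
def L (p : ℕ) : Submodule ℤ[T;T⁻¹] Fock := LinearMap.range (act p)

/-- `x ∈ L` is fixed by the bar involution `[] · u ↦ [] · ū` of `L`. -/
def IsBarInvariant (p : ℕ) (x : Fock) : Prop :=
  ∃ u : Words p, act p u = x ∧ act p (bar u) = x

/-- All coefficients of `x` lie in `q ℤ[q]`. -/
def InQLattice (x : Fock) : Prop :=
  ∀ l, ∃ f : Polynomial ℤ, x l = q * Polynomial.toLaurent f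

/-- The `p`-regular partitions. -/
abbrev Reg (p : ℕ) : Type := {l : YoungDiagram // IsRegular p l}

/-- `B` is the global crystal basis of `L`. -/
structure IsGlobalCrystalBasis (p : ℕ) (B : Reg p → Fock) : Prop where
  linearIndependent : LinearIndependent ℤ[T;T⁻¹] B
  span_eq : Submodule.span ℤ[T;T⁻¹] (Set.range B) = L p
  congr_q : ∀ μ, InQLattice (B μ - vec μ.1)
  bar_eq : ∀ μ, IsBarInvariant p (B μ)

/-- The submodule spanned by the partitions with largest part smaller than `n - m`, where `n` is
the number partitioned. -/
def fockGT (m : ℕ) : Submodule ℤ[T;T⁻¹] Fock :=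
  Submodule.span ℤ[T;T⁻¹] (vec '' {l | l ∉ ptn l.card m})

/-- The truncated Fock space. -/
abbrev TruncFock (m : ℕ) : Type := Fock ⧸ fockGT m

/-- The projection to the truncated Fock space. -/
def proj (m : ℕ) : Fock →ₗ[ℤ[T;T⁻¹]] TruncFock m := (fockGT m).mkQ

/-- `y` lies in the image of `L` in the truncated Fock space, is fixed by the involution
induced there by the bar involution, and is congruent to `μ` modulo the `q ℤ[q]`-span of the
partitions. -/
def IsTruncCrystal (p m : ℕ) (μ : YoungDiagram) (y : TruncFock m) : Prop :=
  (∃ u : Words p, proj m (act p u) = y ∧ proj m (act p (bar u)) = y) ∧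
    ∃ x : Fock, InQLattice x ∧ y - proj m (vec μ) = proj m x

/-- The part of the crystallized decomposition matrix with rows indexed by the partitions of `n`
with largest part at least `n - m`, and columns indexed by the `p`-regular ones among them. -/
def crystDecMatrix {p : ℕ} (B : Reg p → Fock) (n m : ℕ) :
    Matrix {l : YoungDiagram // l ∈ ptn n m} {μ : Reg p // μ.1 ∈ ptn n m} ℤ[T;T⁻¹] :=
  Matrix.of fun l μ => B μ.1 l.1

/-! ### The explicit table for `p = 3` and `m = 4` -/

/-- The tails labelling the rows. -/
def rowTail : Fin 12 → List ℕ :=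
  ![[], [1], [2], [1, 1], [3], [2, 1], [1, 1, 1], [4], [3, 1], [2, 2], [2, 1, 1], [1, 1, 1, 1]]

/-- The tails labelling the columns. -/
def colTail : Fin 10 → List ℕ :=
  ![[], [1], [2], [1, 1], [3], [2, 1], [4], [3, 1], [2, 2], [2, 1, 1]]

/-- The bounds for `n` from which on the columns are given by the table. -/
def bound : Fin 10 → ℕ := ![7, 7, 6, 5, 7, 6, 8, 7, 7, 6]

/-- The Kronecker symbol `δ_i`, as a function of the residue class `r` of `n` modulo `3`. -/
def δ (i r : ZMod 3) : ℤ[T;T⁻¹] := if r = i then 1 else 0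

/-- The crystallized decomposition matrix, as a function of the residue class `r` of `n`
modulo `3`. -/
def table (r : ZMod 3) : Matrix (Fin 12) (Fin 10) ℤ[T;T⁻¹] :=
  !![1, 0, 0, 0, 0, 0, 0, 0, 0, 0;
     q * δ 0 r, 1, 0, 0, 0, 0, 0, 0, 0, 0;
     q * δ 1 r, q * δ 2 r, 1, 0, 0, 0, 0, 0, 0, 0;
     0, q * δ 0 r, 0, 1, 0, 0, 0, 0, 0, 0;
     0, q * δ 0 r, q * δ 1 r, 0, 1, 0, 0, 0, 0, 0;
     q, q ^ 2 * δ 0 r, q ^ 2 * δ 1 r, q * δ 0 r, q, 1, 0, 0, 0, 0;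
     0, 0, 0, q ^ 2 * δ 0 r, 0, q, 0, 0, 0, 0;
     0, 0, q * δ 2 r, 0, q * δ 0 r, 0, 1, 0, 0, 0;
     0, 0, 0, q * δ 1 r, q ^ 2 * δ 2 r, q * δ 2 r, 0, 1, 0, 0;
     q ^ 2 * δ 0 r, q, q ^ 2 * δ 2 r, 0, q ^ 2 * δ 0 r, q * δ 0 r, q, 0, 1, 0;
     q * δ 1 r, 0, 0, 0, q * δ 1 r, q ^ 2 * δ 1 r, 0, 0, 0, 1;
     0, 0, 0, 0, 0, q ^ 2 * δ 0 r, 0, 0, q, 0]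

/-- The element of the truncated Fock space given by column `j` of the table, for `n`. -/
def column (n : ℕ) (j : Fin 10) : TruncFock 4 :=
  proj 4 (∑ i : Fin 12, table (n : ZMod 3) i j • vec (withTail n (rowTail i)))

end LLT

end

open LLT

/-!
The submodule `fockGT 4` is stable under all `F_i^{(k)}`, because adding nodes lengthens the first
row by at most one. So the operators act on the truncated Fock space, where only few partitions of
each `n` are left and `F_i^{(k)}` vanishes for `k ≥ 6`.

Let `basis n` be the columns of the table which are valid for `n`, together with the truncated
members of the global crystal basis that are not given by the table, all of which have degree at
most `6`. Two facts about the combinations of these vectors with coefficients invariant under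
`q ↦ q⁻¹` carry the proof.
* They are stable under the operators (`truncF_mem_basisLattice`). Hence they contain the image of
  every word in the operators.
* Conversely, every basis vector is such a combination of images of words
  (`basis_mem_wordLattice`): it is obtained by applying some `F_i` to a basis vector of one degree
  less and subtracting a bar invariant combination of other basis vectors.

Both are finite computations. If the first row is long enough, then adding three nodes to it
changes nothing in the combinatorics (`fTerms_shift`), and the table has period three in `n`. So it
suffices to treat `n < 13`, where partitions are represented by lists of row lengths and the
identities are evaluated (`spans_basis`, `reaches_basis`).

The second fact shows that each column is fixed by the induced bar involution. For the uniqueness,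
the basis vectors are congruent to distinct partitions modulo `q ℤ[q]`. So a combination of them
has all its coefficients at partitions in `q ^ d ℤ[q]` only if the coefficients of the combination
are there (`mem_ordGE_of_sum_mem`). For all `d` this is linear independence; hence an element of the
truncation of `L` that is fixed by the bar involution has bar invariant coefficients in the basis.
If it is in the `q ℤ[q]`-span of the partitions, then these lie in `q ℤ[q]`, and they vanish
(`eq_zero_of_bar_of_mem_ordGE`). The projection of a member of the global crystal basis has the
defining properties of the column, so it equals the column.
-/

namespace LLT

/-! ### Partitions as lists of row lengths -/

/-- A `ℕ[q, q⁻¹]`-linear combination of partitions, as the list of its terms `q ^ e · w`; the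
partition `w` is given by its list of row lengths. -/
abbrev Terms : Type := List (ℤ × List ℕ)

/-- The length of row `a` of the partition with row lengths `w`. -/
def rowOf (w : List ℕ) (a : ℕ) : ℕ := w.getD a 0

/-- Row `a` of a partition with row lengths `f` has an addable node of residue `i < 3`. -/
def addRow (i : ℕ) (f : ℕ → ℕ) (a : ℕ) : Bool :=
  (a == 0 || decide (f a < f (a - 1))) && (f a + 2 * a) % 3 == i

/-- Row `a` of a partition with row lengths `f` has a removable node of residue `i < 3`. -/
def remRow (i : ℕ) (f : ℕ → ℕ) (a : ℕ) : Bool :=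
  decide (f (a + 1) < f a) && (f a - 1 + 2 * a) % 3 == i

/-- The row lengths after adding a node to each row in `A`. -/
def bump (f : ℕ → ℕ) (A : List ℕ) (a : ℕ) : ℕ := f a + if a ∈ A then 1 else 0

/-- `bump` on lists of row lengths. -/
def bumpList (w A : List ℕ) : List ℕ :=
  ((List.range (w.length + 1)).map (bump (rowOf w) A)).filter (0 < ·)

/-- The exponent of `q` for adding nodes of residue `i` to the rows in `A`. Nodes of one
residue that are strictly to the right of each other are those in rows strictly above. -/
def rowExpo (i : ℕ) (f : ℕ → ℕ) (A : List ℕ) : ℤ :=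
  (A.map fun a => ((List.range a).countP (addRow i (bump f A)) : ℤ)
    - (List.range a).countP (remRow i f)).sum

/-- The terms of the image of the partition `w` under `F_i^{(k)}` which survive in the
truncated Fock space. -/
def fTerms (i k : ℕ) (w : List ℕ) : Terms :=
  ((((List.range (w.length + 1)).filter (addRow i (rowOf w))).sublistsLen k).map fun A =>
    (rowExpo i (rowOf w) A, bumpList w A)).filter fun x => x.2.sum ≤ x.2.headD 0 + 4

/-- `fTerms`, extended linearly. -/
def fApply (i k : ℕ) (v : Terms) : Terms :=
  v.flatMap fun x => (fTerms i k x.2).map fun y => (x.1 + y.1, y.2)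

/-- The partition labelling a basis vector, which is its first term. -/
def label (C : Terms) : List ℕ := (C.headD (0, [])).2

/-- The product of `∑ q ^ e`, for `e` in `es`, and `C`. -/
def scale (es : List ℤ) (C : Terms) : Terms :=
  es.flatMap fun e => C.map fun x => (e + x.1, x.2)

/-- The exponents at `μ` in `v`. -/
def expsAt (μ : List ℕ) (v : Terms) : List ℤ := (v.filter fun x => x.2 == μ).map Prod.fst

/-- Writes `v` as a linear combination of the vectors in a list with bar invariant
coefficients: the coefficient of each vector is read off at its label. -/
def spans : List Terms → Terms → Bool
  | [], v => v.isEmpty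
  | C :: Cs, v =>
    (expsAt (label C) v).isPerm ((expsAt (label C) v).map fun e => -e) &&
    (v.isPerm (scale (expsAt (label C) v) C ++ v.diff (scale (expsAt (label C) v) C)) &&
    spans Cs (v.diff (scale (expsAt (label C) v) C)))

/-- Every vector in the second list is obtained by applying some `F_i` to a vector of the first
list and subtracting a bar invariant combination of later vectors of the second list. -/
def reaches (prev : List Terms) : List Terms → Bool
  | [] => true
  | C :: Cs =>
    ((List.range 3).any fun i => prev.any fun C' =>
      (fApply i 1 C').isPerm (C ++ (fApply i 1 C').diff C) &&
        spans Cs ((fApply i 1 C').diff C)) && reaches prev Cs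

/-- The columns of the table: exponent, residues of `n` modulo `3`, and tail of each entry. -/
def colData : Fin 10 → List (ℕ × List ℕ × List ℕ) :=
  ![[(0, [0, 1, 2], []), (1, [0], [1]), (1, [1], [2]), (1, [0, 1, 2], [2, 1]),
      (2, [0], [2, 2]), (1, [1], [2, 1, 1])],
    [(0, [0, 1, 2], [1]), (1, [2], [2]), (1, [0], [1, 1]), (1, [0], [3]), (2, [0], [2, 1]),
      (1, [0, 1, 2], [2, 2])],
    [(0, [0, 1, 2], [2]), (1, [1], [3]), (2, [1], [2, 1]), (1, [2], [4]), (2, [2], [2, 2])],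
    [(0, [0, 1, 2], [1, 1]), (1, [0], [2, 1]), (2, [0], [1, 1, 1]), (1, [1], [3, 1])],
    [(0, [0, 1, 2], [3]), (1, [0, 1, 2], [2, 1]), (1, [0], [4]), (2, [2], [3, 1]),
      (2, [0], [2, 2]), (1, [1], [2, 1, 1])],
    [(0, [0, 1, 2], [2, 1]), (1, [0, 1, 2], [1, 1, 1]), (1, [2], [3, 1]), (1, [0], [2, 2]),
      (2, [1], [2, 1, 1]), (2, [0], [1, 1, 1, 1])],
    [(0, [0, 1, 2], [4]), (1, [0, 1, 2], [2, 2])],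
    [(0, [0, 1, 2], [3, 1])],
    [(0, [0, 1, 2], [2, 2]), (1, [0, 1, 2], [1, 1, 1, 1])],
    [(0, [0, 1, 2], [2, 1, 1])]]

/-- The column `j` of the table for `n`. -/
def colTerms (n : ℕ) (j : Fin 10) : Terms :=
  ((colData j).filter fun x => n % 3 ∈ x.2.1).map fun x =>
    ((x.1 : ℤ), (n - x.2.2.sum) :: x.2.2)

/-- The truncated members of the global crystal basis which are not given by the table. They are
labelled by the partitions of `n ≤ 6` for which `n` is below the bound of the column. -/
def smallTerms : List Terms :=
  [[(0, [])], [(0, [1])], [(0, [2])], [(0, [1, 1])],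
    [(0, [3]), (1, [2, 1])], [(0, [2, 1]), (1, [1, 1, 1])],
    [(0, [4]), (1, [2, 2])], [(0, [3, 1])], [(0, [2, 2]), (1, [1, 1, 1, 1])], [(0, [2, 1, 1])],
    [(0, [5]), (1, [2, 2, 1])], [(0, [4, 1]), (1, [3, 2])], [(0, [3, 2]), (1, [1, 1, 1, 1, 1])],
    [(0, [2, 2, 1]), (1, [2, 1, 1, 1])],
    [(0, [6]), (1, [3, 2, 1]), (1, [5, 1]), (2, [2, 2, 2])],
    [(0, [5, 1]), (1, [3, 3]), (1, [4, 1, 1]), (2, [3, 2, 1])],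
    [(0, [3, 3]), (1, [2, 1, 1, 1, 1]), (1, [3, 2, 1])]]

/-- The truncations of the members of the global crystal basis in degree `n` which are not zero,
in an order for which the label of a vector does not occur in the later ones. -/
def basis (n : ℕ) : List Terms :=
  (smallTerms.filter fun C => (label C).sum == n) ++
    (((List.finRange 10).filter fun j => bound j ≤ n).map (colTerms n))

/-- For `n < 13`, each `F_i^{(k)}` maps the basis vectors in degree `n` to bar invariant
combinations of those in degree `n + k`. -/
theorem spans_basis : ∀ n < 13, ∀ C ∈ basis n, ∀ i < 3, ∀ k < 6,
    spans (basis (n + k)) (fApply i k C) = true := by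
  decide +kernel

/-- For `n < 13`, the basis vectors in degree `n + 1` are obtained from those in degree `n`. -/
theorem reaches_basis : ∀ n < 13, reaches (basis n) (basis (n + 1)) = true := by
  decide +kernel

/-! ### Adding nodes in terms of row lengths -/

theorem residue_eq_iff {i : ℕ} (hi : i < 3) (a b : ℕ) :
    residue 3 (a, b) = (i : ZMod 3) ↔ (b + 2 * a) % 3 = i := by
  have h : residue 3 (a, b) = ((b + 2 * a : ℕ) : ZMod 3) := by
    have h3 : (3 : ZMod 3) = 0 := rfl
    simp only [residue]
    push_cast
    linear_combination -(a : ZMod 3) * h3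
  rw [h, ZMod.natCast_eq_natCast_iff', Nat.mod_eq_of_lt hi]

theorem rowLen_eq_zero {l : YoungDiagram} {a : ℕ} : l.rowLen a = 0 ↔ l.colLen 0 ≤ a := by
  rw [← not_iff_not, ← ne_eq, ← Nat.pos_iff_ne_zero, ← YoungDiagram.mem_iff_lt_rowLen,
    YoungDiagram.mem_iff_lt_colLen, not_le]

theorem rowOf_rowLens (l : YoungDiagram) : rowOf l.rowLens = l.rowLen := by
  funext a
  by_cases h : a < l.rowLens.length
  · rw [rowOf, List.getD_eq_getElem _ _ h, YoungDiagram.get_rowLens]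
  · rw [rowOf, List.getD_eq_default _ _ (not_lt.1 h), eq_comm, rowLen_eq_zero,
      ← YoungDiagram.length_rowLens]
    exact not_lt.1 h

/-- The bound on the rows in `addable` is automatic. -/
theorem mem_addable {i : ℕ} (hi : i < 3) {l : YoungDiagram} {x : ℕ × ℕ} :
    x ∈ addable 3 (i : ZMod 3) l ↔ x.2 = l.rowLen x.1 ∧ addRow i l.rowLen x.1 = true := by
  obtain ⟨a, b⟩ := x
  simp only [addable, Finset.mem_filter, Finset.mem_image, Finset.mem_range, Prod.mk.injEq,
    residue_eq_iff hi, addRow, Bool.and_eq_true, Bool.or_eq_true, beq_iff_eq, decide_eq_true_eq]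
  constructor
  · rintro ⟨⟨c, -, rfl, rfl⟩, h⟩
    exact ⟨rfl, h⟩
  · rintro ⟨rfl, h, h'⟩
    refine ⟨⟨a, ?_, rfl, rfl⟩, h, h'⟩
    rcases h with rfl | h
    · omega
    · by_contra hc
      have := rowLen_eq_zero.2 (show l.colLen 0 ≤ a - 1 by omega)
      omega

theorem mem_removable {i : ℕ} (hi : i < 3) {l : YoungDiagram} {x : ℕ × ℕ} :
    x ∈ removable 3 (i : ZMod 3) l ↔ x.2 = l.rowLen x.1 - 1 ∧ remRow i l.rowLen x.1 = true := by
  obtain ⟨a, b⟩ := x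
  simp only [removable, Finset.mem_filter, Finset.mem_image, Finset.mem_range, Prod.mk.injEq,
    residue_eq_iff hi, remRow, Bool.and_eq_true, beq_iff_eq, decide_eq_true_eq]
  constructor
  · rintro ⟨⟨c, -, rfl, rfl⟩, h⟩
    exact ⟨rfl, h⟩
  · rintro ⟨rfl, h, h'⟩
    refine ⟨⟨a, ?_, rfl, rfl⟩, h, h'⟩
    by_contra hc
    have := rowLen_eq_zero.2 (not_lt.1 hc)
    omega

/-- The nodes of `l` that are added to the rows in `A`. -/
def endNodes (l : YoungDiagram) (A : Finset ℕ) : Finset (ℕ × ℕ) :=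
  A.map ⟨fun a => (a, l.rowLen a), fun _ _ h => (Prod.mk.inj h).1⟩

theorem mem_endNodes {l : YoungDiagram} {A : Finset ℕ} {x : ℕ × ℕ} :
    x ∈ endNodes l A ↔ x.1 ∈ A ∧ x.2 = l.rowLen x.1 := by
  obtain ⟨a, b⟩ := x
  rw [endNodes, Finset.mem_map]
  constructor
  · rintro ⟨c, hc, h⟩
    cases h
    exact ⟨hc, rfl⟩
  · rintro ⟨h, h'⟩
    exact ⟨a, h, Prod.ext rfl h'.symm⟩

/-- The rows of `l` with an addable node of residue `i`. -/
def addRows (i : ℕ) (l : YoungDiagram) : List ℕ :=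
  (List.range (l.colLen 0 + 1)).filter (addRow i l.rowLen)

theorem addable_eq {i : ℕ} (hi : i < 3) (l : YoungDiagram) :
    addable 3 (i : ZMod 3) l = endNodes l (addRows i l).toFinset := by
  ext ⟨a, b⟩
  simp only [mem_endNodes, mem_addable hi, addRows, List.mem_toFinset, List.mem_filter,
    List.mem_range]
  constructor
  · rintro ⟨rfl, h⟩
    refine ⟨⟨?_, h⟩, rfl⟩
    have := (mem_addable hi (x := (a, l.rowLen a))).2 ⟨rfl, h⟩
    simp only [addable, Finset.mem_filter, Finset.mem_image, Finset.mem_range,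
      Prod.mk.injEq] at this
    obtain ⟨⟨c, hc, rfl, -⟩, -⟩ := this
    exact hc
  · rintro ⟨⟨-, h⟩, rfl⟩
    exact ⟨rfl, h⟩

section AddNodes

variable {i : ℕ} {l : YoungDiagram} {A : List ℕ}

theorem endNodes_subset (hi : i < 3) (hA : A ⊆ addRows i l) :
    endNodes l A.toFinset ⊆ addable 3 (i : ZMod 3) l := by
  rw [addable_eq hi, endNodes, endNodes, Finset.map_subset_map]
  intro a ha
  rw [List.mem_toFinset] at ha ⊢
  exact hA ha

theorem rowLen_addNodes (hi : i < 3) (hA : A ⊆ addRows i l) :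
    (addNodes l (endNodes l A.toFinset)).rowLen = bump l.rowLen A := by
  funext a
  refine eq_of_forall_lt_iff fun b => ?_
  rw [← YoungDiagram.mem_iff_lt_rowLen, ← YoungDiagram.mem_cells,
    addNodes_cells (endNodes_subset hi hA), Finset.mem_union, mem_endNodes,
    YoungDiagram.mem_cells, YoungDiagram.mem_iff_lt_rowLen, List.mem_toFinset, bump]
  split
  · simp_all
    omega
  · simp_all

theorem card_addNodes (hi : i < 3) (hA : A ⊆ addRows i l) (hn : A.Nodup) :
    (addNodes l (endNodes l A.toFinset)).card = l.card + A.length := by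
  rw [YoungDiagram.card, addNodes_cells (endNodes_subset hi hA), Finset.card_union_of_disjoint,
    endNodes, Finset.card_map, List.toFinset_card_of_nodup hn]
  rw [Finset.disjoint_left]
  rintro ⟨a, b⟩ h h'
  rw [YoungDiagram.mem_cells, YoungDiagram.mem_iff_lt_rowLen] at h
  have := (mem_endNodes.1 h').2
  simp only at this
  omega

/-- For nodes of one residue, being strictly to the right is the same as lying strictly above: the
pairs of nodes for which the two notions differ are neighbours, with different residues. -/
theorem expo_eq (hi : i < 3) (hA : A ⊆ addRows i l) (hn : A.Nodup) :
    expo 3 (i : ZMod 3) l (endNodes l A.toFinset) = rowExpo i l.rowLen A := by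
  have hrow := rowLen_addNodes hi hA
  rw [expo, endNodes, Finset.sum_map, ← endNodes, rowExpo, List.sum_toFinset _ hn]
  refine congrArg List.sum (List.map_congr_left fun a ha => ?_)
  have hx : addRow i l.rowLen a = true := by
    have := hA ha
    rw [addRows, List.mem_filter] at this
    exact this.2
  have hxa := hx
  simp only [addRow, Bool.and_eq_true, Bool.or_eq_true, beq_iff_eq, decide_eq_true_eq] at hxa
  have hba : bump l.rowLen A a = l.rowLen a + 1 := by simp [bump, ha]
  have hcount : ∀ P : ℕ → Bool,
      (List.range a).countP P = ((Finset.range a).filter fun b => P b = true).card := by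
    intro P
    rw [List.countP_eq_length_filter, ← List.toFinset_card_of_nodup
      (List.nodup_range.filter _), List.toFinset_filter, List.toFinset_range]
  have hm := hrow ▸ (addNodes l (endNodes l A.toFinset)).rowLen_anti
  have hl := l.rowLen_anti
  change ((Finset.filter (fun y : ℕ × ℕ => l.rowLen a < y.2) _).card : ℤ) -
    (Finset.filter (fun y : ℕ × ℕ => l.rowLen a < y.2) _).card = _
  simp only [hcount]
  congr 2
  · symm
    refine Finset.card_bij (fun b _ => (b, bump l.rowLen A b)) ?_ ?_ ?_
    · intro b hb
      rw [Finset.mem_filter, Finset.mem_range] at hb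
      rw [Finset.mem_filter, mem_addable hi, hrow]
      have := hm _ _ hb.1.le
      exact ⟨⟨rfl, hb.2⟩, by simp only; omega⟩
    · intro b _ c _ h
      exact (Prod.mk.inj h).1
    · rintro ⟨b, c⟩ hb
      rw [Finset.mem_filter, mem_addable hi, hrow] at hb
      obtain ⟨⟨hc, hb⟩, hlt⟩ := hb
      simp only at hc hb hlt
      subst hc
      refine ⟨b, ?_, rfl⟩
      rw [Finset.mem_filter, Finset.mem_range]
      refine ⟨?_, hb⟩
      by_contra hab
      simp only [addRow, Bool.and_eq_true, Bool.or_eq_true, beq_iff_eq,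
        decide_eq_true_eq] at hb
      rcases eq_or_lt_of_le (not_lt.1 hab) with rfl | hab
      -- the next node of the row of an added node has a different residue
      · omega
      · have h1 := hb.1.resolve_left (by omega)
        have h2 := hm a (b - 1) (by omega)
        omega
  · symm
    refine Finset.card_bij (fun b _ => (b, l.rowLen b - 1)) ?_ ?_ ?_
    · intro b hb
      rw [Finset.mem_filter, Finset.mem_range] at hb
      rw [Finset.mem_filter, mem_removable hi]
      refine ⟨⟨rfl, hb.2⟩, ?_⟩
      have hb2 := hb.2
      simp only [remRow, Bool.and_eq_true, beq_iff_eq, decide_eq_true_eq] at hb2 ⊢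
      -- a removable node straight above an addable one has a different residue
      have h1 := hl (b + 1) a (by omega)
      have h2 := hxa.1.resolve_left (by omega)
      by_contra hlt
      rcases Nat.lt_or_ge (b + 1) a with h | h
      · have := hl (b + 1) (a - 1) (by omega)
        omega
      · obtain rfl : a = b + 1 := by omega
        omega
    · intro b _ c _ h
      exact (Prod.mk.inj h).1
    · rintro ⟨b, c⟩ hb
      rw [Finset.mem_filter, mem_removable hi] at hb
      obtain ⟨⟨hc, hb⟩, hlt⟩ := hb
      simp only at hc hb hlt
      subst hc
      refine ⟨b, ?_, rfl⟩
      rw [Finset.mem_filter, Finset.mem_range]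
      refine ⟨?_, hb⟩
      by_contra hab
      have := hl a b (not_lt.1 hab)
      omega

/-- The only row of `bump` which may be empty below `l.colLen 0 + 1` is the last one. -/
theorem rowLens_addNodes (hi : i < 3) (hA : A ⊆ addRows i l) :
    (addNodes l (endNodes l A.toFinset)).rowLens = bumpList l.rowLens A := by
  have hrow := rowLen_addNodes hi hA
  set m := addNodes l (endNodes l A.toFinset)
  obtain ⟨d, hd⟩ : ∃ d, l.colLen 0 + 1 = m.colLen 0 + d := by
    refine Nat.exists_eq_add_of_le (rowLen_eq_zero.1 ?_)
    rw [hrow, bump, if_neg, add_zero, rowLen_eq_zero]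
    · omega
    · intro h
      have := hA h
      rw [addRows, List.mem_filter, List.mem_range] at this
      omega
  rw [bumpList, rowOf_rowLens, ← hrow, YoungDiagram.length_rowLens, hd, List.range_add,
    List.map_append, List.filter_append, List.filter_eq_self.2, List.filter_eq_nil_iff.2,
    List.append_nil]
  · rfl
  · intro x hx
    simp only [List.mem_map] at hx
    obtain ⟨_, ⟨b, -, rfl⟩, rfl⟩ := hx
    rw [rowLen_eq_zero.2 (Nat.le_add_right _ _)]
    simp
  · intro x hx
    exact decide_eq_true (m.pos_of_mem_rowLens x hx)

end AddNodes

open Classical in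
/-- The partition with row lengths `w` (the empty partition if `w` is not weakly decreasing). -/
def ofRows (w : List ℕ) : YoungDiagram :=
  if h : w.SortedGE then YoungDiagram.ofRowLens w h else ⊥

theorem ofRows_rowLens (l : YoungDiagram) : ofRows l.rowLens = l := by
  rw [ofRows, dif_pos l.rowLens_sorted, YoungDiagram.ofRowLens_to_rowLens_eq_self]

/-- `w` is the list of row lengths of a partition. -/
def IsRows (w : List ℕ) : Prop := w.SortedGE ∧ ∀ x ∈ w, 0 < x

theorem rowLens_ofRows {w : List ℕ} (hw : IsRows w) : (ofRows w).rowLens = w := by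
  rw [ofRows, dif_pos hw.1, YoungDiagram.rowLens_ofRowLens_eq_self hw.2]

theorem sum_rowLens (l : YoungDiagram) : l.rowLens.sum = l.card := by
  rw [YoungDiagram.rowLens, YoungDiagram.card, ← List.sum_toFinset _ List.nodup_range,
    List.toFinset_range, Finset.card_eq_sum_card_fiberwise (f := Prod.fst)
      (t := Finset.range (l.colLen 0))]
  · exact Finset.sum_congr rfl fun a _ => l.rowLen_eq_card
  · rintro ⟨a, b⟩ h
    exact Finset.mem_coe.2 (Finset.mem_range.2 ((YoungDiagram.mem_iff_lt_colLen).1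
      (l.up_left_mem le_rfl (Nat.zero_le _) h)))

theorem headD_rowLens (l : YoungDiagram) : l.rowLens.headD 0 = l.rowLen 0 := by
  rw [← rowOf_rowLens, rowOf]
  cases l.rowLens <;> rfl

/-- The value of a combination of partitions in a module, where `P` gives the values of the
partitions. -/
noncomputable def tval {M : Type*} [AddCommGroup M] [Module ℤ[T;T⁻¹] M] (P : List ℕ → M)
    (v : Terms) : M :=
  (v.map fun x => (LaurentPolynomial.T x.1 : ℤ[T;T⁻¹]) • P x.2).sum

theorem sum_powersetCard_endNodes {M : Type*} [AddCommMonoid M] (l : YoungDiagram) {R : List ℕ}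
    (hR : R.Nodup) (k : ℕ) (h : Finset (ℕ × ℕ) → M) :
    ∑ X ∈ (endNodes l R.toFinset).powersetCard k, h X =
      ((R.sublistsLen k).map fun A => h (endNodes l A.toFinset)).sum := by
  rw [endNodes, Finset.powersetCard_map, Finset.sum_map]
  change (((R.toFinset.powersetCard k).val).map fun A => h (endNodes l A)).sum = _
  have h1 : (fun A : Finset ℕ => h (endNodes l A)) =
      (fun m : Multiset ℕ => h (endNodes l m.toFinset)) ∘ Finset.val := by
    funext A
    simp
  rw [h1, ← Multiset.map_map, Finset.map_val_val_powersetCard, List.toFinset_val, hR.dedup,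
    Multiset.powersetCard_coe, Multiset.map_coe, Multiset.sum_coe, List.map_map]
  refine congrArg List.sum (List.map_congr_left fun A _ => ?_)
  simp

theorem F_vec {i : ℕ} (hi : i < 3) (k : ℕ) (l : YoungDiagram) :
    F 3 (i : ZMod 3) k (vec l) = (((addRows i l).sublistsLen k).map fun A =>
      (LaurentPolynomial.T (rowExpo i l.rowLen A) : ℤ[T;T⁻¹]) •
        vec (addNodes l (endNodes l A.toFinset))).sum := by
  have hn : (addRows i l).Nodup := List.nodup_range.filter _
  rw [F, vec, Finsupp.linearCombination_single, one_smul, addable_eq hi,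
    sum_powersetCard_endNodes l hn]
  refine congrArg List.sum (List.map_congr_left fun A hA => ?_)
  rw [List.mem_sublistsLen] at hA
  rw [expo_eq hi hA.1.subset (hn.sublist hA.1)]

theorem proj_vec_eq_zero {m : ℕ} {l : YoungDiagram} (h : l ∉ ptn l.card m) :
    proj m (vec l) = 0 :=
  (Submodule.Quotient.mk_eq_zero _).2 (Submodule.subset_span ⟨l, h, rfl⟩)

theorem mem_ptn_card {m : ℕ} {l : YoungDiagram} :
    l ∈ ptn l.card m ↔ l.rowLens.sum ≤ l.rowLens.headD 0 + m := by
  rw [sum_rowLens, headD_rowLens]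
  exact ⟨fun h => h.2, fun h => ⟨rfl, h⟩⟩

/-- The operators on the truncated Fock space are computed by `fTerms`. -/
theorem proj_F_vec {i : ℕ} (hi : i < 3) (k : ℕ) (l : YoungDiagram) :
    proj 4 (F 3 (i : ZMod 3) k (vec l)) =
      tval (fun w => proj 4 (vec (ofRows w))) (fTerms i k l.rowLens) := by
  rw [F_vec hi, map_list_sum, List.map_map, tval, fTerms, rowOf_rowLens,
    YoungDiagram.length_rowLens, ← addRows]
  have key : ∀ Q : List (List ℕ), (∀ A ∈ Q, A ⊆ addRows i l) →
      (Q.map ((proj 4 : Fock → TruncFock 4) ∘ fun A =>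
        (LaurentPolynomial.T (rowExpo i l.rowLen A) : ℤ[T;T⁻¹]) •
          vec (addNodes l (endNodes l A.toFinset)))).sum =
      (((Q.map fun A => (rowExpo i l.rowLen A, bumpList l.rowLens A)).filter
        fun x => x.2.sum ≤ x.2.headD 0 + 4).map fun x =>
          (LaurentPolynomial.T x.1 : ℤ[T;T⁻¹]) • proj 4 (vec (ofRows x.2))).sum := by
    intro Q
    induction Q with
    | nil => intro _; rfl
    | cons A Q ih =>
      intro hQ
      have hA := hQ A List.mem_cons_self
      have hrl := rowLens_addNodes hi hA
      rw [List.map_cons, List.sum_cons, ih fun B hB => hQ B (List.mem_cons_of_mem _ hB),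
        List.map_cons, Function.comp_apply, map_smul]
      set m := addNodes l (endNodes l A.toFinset)
      by_cases h : m ∈ ptn m.card 4
      · rw [List.filter_cons_of_pos, List.map_cons, List.sum_cons, ← hrl, ofRows_rowLens]
        rw [mem_ptn_card, hrl] at h
        exact decide_eq_true h
      · rw [List.filter_cons_of_neg, proj_vec_eq_zero h, smul_zero, zero_add]
        rw [mem_ptn_card, hrl] at h
        simpa using h
  exact key _ fun A hA => (List.mem_sublistsLen.1 hA).1.subset

/-- Adding `k ≥ 1` nodes lengthens the first row by at most one, so it does not leave `fockGT`,
and leads into it if `k` is large. -/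
theorem F_vec_mem_fockGT {i : ℕ} (hi : i < 3) {k : ℕ} {l : YoungDiagram}
    (h : 6 ≤ k ∨ l ∉ ptn l.card 4) : F 3 (i : ZMod 3) k (vec l) ∈ fockGT 4 := by
  have hn : (addRows i l).Nodup := List.nodup_range.filter _
  rw [F_vec hi]
  refine list_sum_mem fun x hx => ?_
  rw [List.mem_map] at hx
  obtain ⟨A, hA, rfl⟩ := hx
  rw [List.mem_sublistsLen] at hA
  refine Submodule.smul_mem _ _ (Submodule.subset_span ⟨_, fun hm => ?_, rfl⟩)
  have h1 := hm.2
  rw [card_addNodes hi hA.1.subset (hn.sublist hA.1), rowLen_addNodes hi hA.1.subset] at h1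
  have h2 : l.rowLen 0 ≤ l.card := by
    rw [l.rowLen_eq_card]
    exact Finset.card_le_card (Finset.filter_subset _ _)
  have h3 : (if 0 ∈ A then 1 else 0) ≤ A.length := by
    split
    · exact List.length_pos_of_mem ‹_›
    · exact Nat.zero_le _
  have h4 : (if 0 ∈ A then 1 else 0) ≤ 1 := by split <;> omega
  simp only [ptn, Set.mem_ofPred_eq, true_and, bump] at h h1
  omega

/-! ### The truncated operators and the shift of the first row -/

theorem F_mem_fockGT (i : ZMod 3) (k : ℕ) : fockGT 4 ≤ (fockGT 4).comap (F 3 i k) := by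
  rw [fockGT, Submodule.span_le]
  rintro _ ⟨l, hl, rfl⟩
  rw [← ZMod.natCast_zmod_val i]
  exact F_vec_mem_fockGT (ZMod.val_lt i) (Or.inr hl)

/-- The operator `F_i^{(k)}` on the truncated Fock space. -/
noncomputable def truncF (i : ZMod 3) (k : ℕ) : TruncFock 4 →ₗ[ℤ[T;T⁻¹]] TruncFock 4 :=
  (fockGT 4).mapQ (fockGT 4) (F 3 i k) (F_mem_fockGT i k)

theorem truncF_proj (i : ZMod 3) (k : ℕ) (x : Fock) :
    truncF i k (proj 4 x) = proj 4 (F 3 i k x) := rfl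

theorem truncF_eq_zero (i : ZMod 3) {k : ℕ} (hk : 6 ≤ k) : truncF i k = 0 := by
  ext l
  rw [← ZMod.natCast_zmod_val i]
  exact (Submodule.Quotient.mk_eq_zero _).2 (F_vec_mem_fockGT (ZMod.val_lt i) (Or.inl hk))

/-- The image in the truncated Fock space of the partition with row lengths `w`. -/
noncomputable def pvec (w : List ℕ) : TruncFock 4 := proj 4 (vec (ofRows w))

/-- The partition obtained by adding `3 * s` nodes to the first row. -/
def shiftRow (s : ℕ) : List ℕ → List ℕ
  | [] => []
  | m :: t => (m + 3 * s) :: t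

/-- `shiftRow` applied to all partitions in a linear combination. -/
def shiftTerms (s : ℕ) (v : Terms) : Terms := v.map fun x => (x.1, shiftRow s x.2)

theorem shiftRow_zero : shiftRow 0 = id := by
  funext w
  cases w <;> rfl

theorem addRow_congr {f g : ℕ → ℕ} (h0 : f 0 % 3 = g 0 % 3) (hf : f 1 < f 0) (hg : g 1 < g 0)
    (h : ∀ a, f (a + 1) = g (a + 1)) (i : ℕ) : addRow i f = addRow i g := by
  funext a
  match a with
  | 0 => simp [addRow, h0]
  | 1 =>
    change ((1 == 0 || decide (f 1 < f 0)) && _) = ((1 == 0 || decide (g 1 < g 0)) && _)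
    rw [decide_eq_true hf, decide_eq_true hg, h 0]
  | a + 2 => simp [addRow, h]

theorem remRow_congr {f g : ℕ → ℕ} (h0 : f 0 % 3 = g 0 % 3) (hf : f 1 < f 0) (hg : g 1 < g 0)
    (h : ∀ a, f (a + 1) = g (a + 1)) (i : ℕ) : remRow i f = remRow i g := by
  funext a
  match a with
  | 0 =>
    have : (f 0 - 1) % 3 = (g 0 - 1) % 3 := by omega
    simp [remRow, hf, hg, this]
  | a + 1 => simp [remRow, h]

theorem bumpList_cons {m : ℕ} (hm : 0 < m) (t A : List ℕ) :
    bumpList (m :: t) A = bump (rowOf (m :: t)) A 0 ::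
      ((List.range (t.length + 1)).map
        fun a => rowOf t a + if a + 1 ∈ A then 1 else 0).filter (0 < ·) := by
  rw [bumpList, List.length_cons, List.range_succ_eq_map, List.map_cons, List.filter_cons_of_pos,
    List.map_map]
  · rfl
  · have : 0 < bump (rowOf (m :: t)) A 0 := Nat.lt_of_lt_of_le hm (Nat.le_add_right _ _)
    simpa using this

/-- If the first row is long enough, then adding multiples of `3` to it does not change how nodes
are added to a partition. -/
theorem fTerms_shift {m : ℕ} {t : List ℕ} (h : t.headD 0 + 1 < m) (s i k : ℕ) :
    fTerms i k ((m + 3 * s) :: t) = shiftTerms s (fTerms i k (m :: t)) := by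
  have h1 : rowOf (m :: t) 1 = t.headD 0 := by cases t <;> rfl
  have h1' : rowOf ((m + 3 * s) :: t) 1 = t.headD 0 := by cases t <;> rfl
  have h0 : rowOf (m :: t) 0 = m := rfl
  have h0' : rowOf ((m + 3 * s) :: t) 0 = m + 3 * s := rfl
  have hA : ∀ A : List ℕ, bump (rowOf ((m + 3 * s) :: t)) A 0 =
      bump (rowOf (m :: t)) A 0 + 3 * s := by
    intro A
    rw [bump, bump, h0, h0']
    omega
  have hb : ∀ A, bumpList ((m + 3 * s) :: t) A = shiftRow s (bumpList (m :: t) A) := by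
    intro A
    rw [bumpList_cons (by omega), bumpList_cons (by omega), shiftRow, hA]
  have he : ∀ A, rowExpo i (rowOf ((m + 3 * s) :: t)) A = rowExpo i (rowOf (m :: t)) A := by
    intro A
    have hlt : bump (rowOf (m :: t)) A 1 < bump (rowOf (m :: t)) A 0 := by
      rw [bump, bump, h0, h1]
      split <;> split <;> omega
    have hlt' : bump (rowOf ((m + 3 * s) :: t)) A 1 < bump (rowOf ((m + 3 * s) :: t)) A 0 := by
      rw [bump, bump, h0', h1']
      split <;> split <;> omega
    rw [rowExpo, rowExpo, addRow_congr (f := bump (rowOf ((m + 3 * s) :: t)) A)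
      (g := bump (rowOf (m :: t)) A) (by rw [hA]; omega) hlt' hlt (fun a => rfl),
      remRow_congr (f := rowOf ((m + 3 * s) :: t)) (g := rowOf (m :: t)) (by omega) (by omega)
      (by omega) (fun a => rfl)]
  rw [fTerms, fTerms, shiftTerms, addRow_congr (f := rowOf ((m + 3 * s) :: t))
    (g := rowOf (m :: t)) (by omega) (by omega) (by omega) (fun a => rfl), List.length_cons,
    List.length_cons]
  simp only [he, hb]
  generalize List.sublistsLen k _ = Q
  induction Q with
  | nil => rfl
  | cons A Q ih =>
    have hiff : ((shiftRow s (bumpList (m :: t) A)).sum ≤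
        (shiftRow s (bumpList (m :: t) A)).headD 0 + 4) ↔
        (bumpList (m :: t) A).sum ≤ (bumpList (m :: t) A).headD 0 + 4 := by
      rw [bumpList_cons (by omega)]
      simp only [shiftRow, List.sum_cons, List.headD_cons]
      omega
    rw [List.map_cons, List.map_cons, List.filter_cons, List.filter_cons, ih]
    simp only [hiff]
    split <;> rfl

/-- The operators act in the same way on `w` and on `shiftRow s w`. -/
def IsStable (s : ℕ) (w : List ℕ) : Prop :=
  IsRows w ∧ (s = 0 ∨ w.tail.headD 0 + 1 < w.headD 0)

theorem IsStable.fTerms {s : ℕ} {w : List ℕ} (h : IsStable s w) (i k : ℕ) :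
    fTerms i k (shiftRow s w) = shiftTerms s (fTerms i k w) := by
  rcases h.2 with rfl | h'
  · rw [shiftRow_zero, shiftTerms, shiftRow_zero]
    simp
  · cases w with
    | nil => simp at h'
    | cons m t => exact fTerms_shift h' s i k

theorem IsStable.isRows {s : ℕ} {w : List ℕ} (h : IsStable s w) : IsRows (shiftRow s w) := by
  cases w with
  | nil => exact h.1
  | cons m t =>
    obtain ⟨⟨h1, h2⟩, -⟩ := h
    rw [List.sortedGE_iff_pairwise, List.pairwise_cons] at h1
    refine ⟨?_, ?_⟩
    · rw [shiftRow, List.sortedGE_iff_pairwise, List.pairwise_cons]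
      exact ⟨fun a ha => (h1.1 a ha).trans (Nat.le_add_right _ _), h1.2⟩
    · intro x hx
      rcases List.mem_cons.1 hx with rfl | hx
      · have := h2 m List.mem_cons_self
        omega
      · exact h2 x (List.mem_cons_of_mem _ hx)

/-! ### Evaluation of linear combinations -/

section Eval

variable {M : Type*} [AddCommGroup M] [Module ℤ[T;T⁻¹] M] (P : List ℕ → M)

theorem tval_cons (x : ℤ × List ℕ) (v : Terms) :
    tval P (x :: v) = (LaurentPolynomial.T x.1 : ℤ[T;T⁻¹]) • P x.2 + tval P v := by
  simp [tval]

theorem tval_append (v w : Terms) : tval P (v ++ w) = tval P v + tval P w := by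
  simp [tval]

theorem tval_perm {v w : Terms} (h : v.Perm w) : tval P v = tval P w :=
  (h.map _).sum_eq

theorem tval_translate (e : ℤ) (v : Terms) :
    tval P (v.map fun x => (e + x.1, x.2)) = (LaurentPolynomial.T e : ℤ[T;T⁻¹]) • tval P v := by
  induction v with
  | nil => simp [tval]
  | cons x v ih =>
    rw [List.map_cons, tval_cons, ih, tval_cons, smul_add, smul_smul, LaurentPolynomial.T_add]

theorem tval_scale (es : List ℤ) (v : Terms) :
    tval P (scale es v) =
      (es.map fun e => (LaurentPolynomial.T e : ℤ[T;T⁻¹])).sum • tval P v := by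
  induction es with
  | nil => simp [tval, scale]
  | cons e es ih =>
    rw [scale, List.flatMap_cons, tval_append, ← scale, ih, tval_translate, List.map_cons,
      List.sum_cons, add_smul]

theorem tval_shiftTerms (s : ℕ) (v : Terms) :
    tval P (shiftTerms s v) = tval (P ∘ shiftRow s) v := by
  rw [tval, shiftTerms, List.map_map]
  rfl

theorem map_tval {N : Type*} [AddCommGroup N] [Module ℤ[T;T⁻¹] N] (f : M →ₗ[ℤ[T;T⁻¹]] N)
    (v : Terms) : f (tval P v) = tval (f ∘ P) v := by
  induction v with
  | nil => simp [tval]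
  | cons x v ih => rw [tval_cons, tval_cons, map_add, ih, map_smul]; rfl

/-- The Laurent polynomials which are invariant under `q ↦ q⁻¹`. -/
noncomputable def barFixed : Subring ℤ[T;T⁻¹] :=
  RingHom.eqLocus (LaurentPolynomial.invert (R := ℤ) : ℤ[T;T⁻¹] →+* ℤ[T;T⁻¹]) (RingHom.id _)

theorem mem_barFixed {f : ℤ[T;T⁻¹]} : f ∈ barFixed ↔ LaurentPolynomial.invert f = f := Iff.rfl

theorem sum_T_mem_barFixed {es : List ℤ} (h : es.Perm (es.map fun e => -e)) :
    (es.map fun e => (LaurentPolynomial.T e : ℤ[T;T⁻¹])).sum ∈ barFixed := by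
  rw [mem_barFixed, map_list_sum, List.map_map]
  refine Eq.trans ?_ (h.map _).sum_eq.symm
  rw [List.map_map]
  refine congrArg List.sum (List.map_congr_left fun e _ => ?_)
  simp

/-- The coefficients found by `spans` are sums of powers `q ^ e` over lists of exponents invariant
under `e ↦ -e`. -/
theorem tval_mem_of_spans {Cs : List Terms} {v : Terms} (h : spans Cs v = true) :
    tval P v ∈ Submodule.span barFixed (tval P '' {C | C ∈ Cs}) := by
  induction Cs generalizing v with
  | nil =>
    rw [spans, List.isEmpty_iff] at h
    rw [h]
    exact Submodule.zero_mem _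
  | cons C Cs ih =>
    simp only [spans, Bool.and_eq_true, List.isPerm_iff] at h
    obtain ⟨h1, h2, h3⟩ := h
    rw [tval_perm P h2, tval_append, tval_scale]
    refine add_mem ?_ (Submodule.span_mono (Set.image_mono fun C hC => ?_) (ih h3))
    · exact Submodule.smul_mem _ (⟨_, sum_T_mem_barFixed h1⟩ : barFixed)
        (Submodule.subset_span ⟨C, List.mem_cons_self, rfl⟩)
    · exact List.mem_cons_of_mem _ hC

end Eval

theorem truncF_pvec {s : ℕ} {w : List ℕ} (h : IsStable s w) {i : ℕ} (hi : i < 3) (k : ℕ) :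
    truncF i k (pvec (shiftRow s w)) = tval (pvec ∘ shiftRow s) (fTerms i k w) := by
  rw [pvec, truncF_proj, proj_F_vec hi, rowLens_ofRows h.isRows, h.fTerms]
  exact tval_shiftTerms pvec s _

theorem truncF_tval {s : ℕ} {v : Terms} (h : ∀ x ∈ v, IsStable s x.2) {i : ℕ} (hi : i < 3)
    (k : ℕ) : truncF i k (tval (pvec ∘ shiftRow s) v) =
      tval (pvec ∘ shiftRow s) (fApply i k v) := by
  induction v with
  | nil => simp [tval, fApply]
  | cons x v ih =>
    have hc : fApply i k (x :: v) =
        (fTerms i k x.2).map (fun y => (x.1 + y.1, y.2)) ++ fApply i k v := rfl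
    rw [hc, tval_append, tval_translate, tval_cons, map_add, map_smul,
      ih fun y hy => h y (List.mem_cons_of_mem _ hy), Function.comp_apply,
      truncF_pvec (h x List.mem_cons_self) hi]

/-! ### The bar invariant lattice spanned by the basis -/

theorem colTerms_add {n : ℕ} (hn : 8 ≤ n) (s : ℕ) (j : Fin 10) :
    colTerms (n + 3 * s) j = shiftTerms s (colTerms n j) := by
  have hs : ∀ j : Fin 10, ∀ x ∈ colData j, x.2.2.sum ≤ 4 := by decide
  rw [colTerms, colTerms, shiftTerms, List.map_map, Nat.add_mul_mod_self_left]
  refine List.map_congr_left fun x hx => ?_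
  have := hs j x (List.mem_filter.1 hx).1
  simp only [Function.comp_apply, shiftRow]
  congr 2
  omega

theorem basis_of_le {n : ℕ} (hn : 8 ≤ n) :
    basis n = (List.finRange 10).map (colTerms n) := by
  have hs : ∀ C ∈ smallTerms, (label C).sum < 8 := by decide
  have hb : ∀ j, bound j ≤ 8 := by decide
  rw [basis, List.filter_eq_nil_iff.2, List.nil_append, List.filter_eq_self.2]
  · exact fun j _ => decide_eq_true ((hb j).trans hn)
  · intro C hC
    have := hs C hC
    rw [beq_iff_eq]
    omega

theorem basis_add {n s : ℕ} (h : s = 0 ∨ 8 ≤ n) :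
    basis (n + 3 * s) = (basis n).map (shiftTerms s) := by
  rcases h with rfl | h
  · have : shiftTerms 0 = id := by
      funext v
      rw [shiftTerms, shiftRow_zero]
      simp
    rw [this, List.map_id]
    rfl
  · rw [basis_of_le h, basis_of_le (by omega), List.map_map]
    exact List.map_congr_left fun j _ => colTerms_add h s j

theorem isRows_basis : ∀ n < 13, ∀ C ∈ basis n, ∀ x ∈ C,
    x.2.IsChain (· ≥ ·) ∧ (∀ a ∈ x.2, 0 < a) ∧ (10 ≤ n → x.2.tail.headD 0 + 1 < x.2.headD 0) := by
  decide +kernel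

theorem isStable_basis {n s : ℕ} (hn : n < 13) (hs : s = 0 ∨ 10 ≤ n) {C : Terms}
    (hC : C ∈ basis n) {x : ℤ × List ℕ} (hx : x ∈ C) : IsStable s x.2 := by
  obtain ⟨h1, h2, h3⟩ := isRows_basis n hn C hC x hx
  exact ⟨⟨h1.sortedGE, h2⟩, hs.imp id h3⟩

/-- Every degree is reached by shifts from one below `13`. For `n ≥ 10` the first row is long enough
for `fTerms_shift`, as the tails have at most `4` nodes. -/
theorem exists_eq_add (n : ℕ) : ∃ m s, n = m + 3 * s ∧ m < 13 ∧ (s = 0 ∨ 10 ≤ m) := by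
  rcases Nat.lt_or_ge n 13 with h | h
  · exact ⟨n, 0, rfl, h, Or.inl rfl⟩
  · exact ⟨10 + (n - 10) % 3, (n - 10) / 3, by omega, by omega, Or.inr (by omega)⟩

/-- The combinations with bar invariant coefficients of the basis vectors. -/
noncomputable def basisLattice : Submodule barFixed (TruncFock 4) :=
  Submodule.span barFixed (tval pvec '' {C | ∃ n, C ∈ basis n})

theorem truncF_mem_basisLattice (i : ZMod 3) (k : ℕ) {y : TruncFock 4} (hy : y ∈ basisLattice) :
    truncF i k y ∈ basisLattice := by
  rcases Nat.lt_or_ge k 6 with hk | hk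
  swap
  · rw [truncF_eq_zero i hk]
    exact Submodule.zero_mem _
  induction hy using Submodule.span_induction with
  | zero => rw [map_zero]; exact Submodule.zero_mem _
  | add x y _ _ hx hy => rw [map_add]; exact add_mem hx hy
  | smul a x _ hx =>
    rw [Subring.smul_def, map_smul, ← Subring.smul_def]
    exact Submodule.smul_mem _ a hx
  | mem x hx =>
    obtain ⟨C, ⟨n, hC⟩, rfl⟩ := hx
    obtain ⟨m, s, rfl, hm, hs⟩ := exists_eq_add n
    rw [basis_add (hs.imp id (by omega)), List.mem_map] at hC
    obtain ⟨C, hC, rfl⟩ := hC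
    rw [tval_shiftTerms, ← ZMod.natCast_zmod_val i,
      truncF_tval (fun x hx => isStable_basis hm hs hC hx) (ZMod.val_lt i)]
    refine Submodule.span_mono ?_ (tval_mem_of_spans _
      (spans_basis m hm C hC _ (ZMod.val_lt i) k hk))
    rintro _ ⟨D, hD, rfl⟩
    refine ⟨shiftTerms s D, ⟨m + k + 3 * s, ?_⟩, tval_shiftTerms _ _ _⟩
    rw [basis_add (hs.imp id (by omega))]
    exact List.mem_map_of_mem hD

theorem pvec_nil : pvec [] = proj 4 (vec ⊥) := by
  have : ofRows [] = ⊥ := by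
    ext ⟨a, b⟩
    rw [ofRows, dif_pos (List.Pairwise.nil).sortedGE]
    simp [YoungDiagram.mem_cells, YoungDiagram.mem_ofRowLens]
  rw [pvec, this]

theorem applyWord_append (w : List (ZMod 3 × ℕ)) (g : ZMod 3 × ℕ) :
    applyWord 3 (w ++ [g]) = F 3 g.1 g.2 (applyWord 3 w) := by
  rw [applyWord, List.foldl_append]
  rfl

theorem applyWord_mem_basisLattice (w : List (ZMod 3 × ℕ)) :
    proj 4 (applyWord 3 w) ∈ basisLattice := by
  induction w using List.reverseRecOn with
  | nil =>
    refine Submodule.subset_span ⟨[(0, [])], ⟨0, by decide⟩, ?_⟩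
    simp [tval, pvec_nil, applyWord]
  | append_singleton w g ih =>
    rw [applyWord_append, ← truncF_proj]
    exact truncF_mem_basisLattice _ _ ih

/-- The combinations with bar invariant coefficients of the images of words. -/
noncomputable def wordLattice : Submodule barFixed (TruncFock 4) :=
  Submodule.span barFixed (Set.range fun w => proj 4 (applyWord 3 w))

theorem truncF_mem_wordLattice (i : ZMod 3) (k : ℕ) {y : TruncFock 4} (hy : y ∈ wordLattice) :
    truncF i k y ∈ wordLattice := by
  induction hy using Submodule.span_induction with
  | zero => rw [map_zero]; exact Submodule.zero_mem _
  | add x y _ _ hx hy => rw [map_add]; exact add_mem hx hy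
  | smul a x _ hx =>
    rw [Subring.smul_def, map_smul, ← Subring.smul_def]
    exact Submodule.smul_mem _ a hx
  | mem x hx =>
    obtain ⟨w, rfl⟩ := hx
    exact Submodule.subset_span ⟨w ++ [(i, k)], congrArg (proj 4) (applyWord_append w (i, k))⟩

/-- The basis vectors of one degree are obtained by induction from the last to the first. -/
theorem mem_wordLattice_of_reaches {s : ℕ} {prev Cs : List Terms}
    (hst : ∀ C ∈ prev, ∀ x ∈ C, IsStable s x.2)
    (hprev : ∀ C ∈ prev, tval (pvec ∘ shiftRow s) C ∈ wordLattice)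
    (h : reaches prev Cs = true) {C : Terms} (hC : C ∈ Cs) :
    tval (pvec ∘ shiftRow s) C ∈ wordLattice := by
  induction Cs generalizing C with
  | nil => cases hC
  | cons D Cs ih =>
    simp only [reaches, Bool.and_eq_true, List.any_eq_true, List.mem_range,
      List.isPerm_iff] at h
    obtain ⟨⟨i, hi, C', hC', hperm, hspan⟩, h⟩ := h
    rcases List.mem_cons.1 hC with rfl | hC
    · have h1 := truncF_tval (hst C' hC') hi 1
      rw [tval_perm _ hperm, tval_append] at h1
      rw [← sub_eq_iff_eq_add.2 h1]
      refine sub_mem (truncF_mem_wordLattice _ _ (hprev C' hC')) ?_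
      refine Submodule.span_le.2 ?_ (tval_mem_of_spans _ hspan)
      rintro _ ⟨E, hE, rfl⟩
      exact ih h hE
    · exact ih h hC

theorem basis_mem_wordLattice (n : ℕ) {C : Terms} (hC : C ∈ basis n) :
    tval pvec C ∈ wordLattice := by
  induction n generalizing C with
  | zero =>
    have h0 : basis 0 = [[(0, [])]] := by decide
    rw [h0, List.mem_singleton] at hC
    refine Submodule.subset_span ⟨[], ?_⟩
    simp [hC, tval, pvec_nil, applyWord]
  | succ n ih =>
    obtain ⟨m, s, rfl, hm, hs⟩ := exists_eq_add n
    rw [Nat.add_right_comm, basis_add (hs.imp id (by omega)), List.mem_map] at hC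
    obtain ⟨C, hC, rfl⟩ := hC
    rw [tval_shiftTerms]
    refine mem_wordLattice_of_reaches (fun C hC x hx => isStable_basis hm hs hC hx)
      (fun D hD => ?_) (reaches_basis m hm) hC
    rw [← tval_shiftTerms]
    refine ih ?_
    rw [basis_add (hs.imp id (by omega))]
    exact List.mem_map_of_mem hD

/-! ### Uniqueness -/

/-- The Laurent polynomials in `q ^ a ℤ[q]`. -/
noncomputable def ordGE (a : ℤ) : AddSubgroup ℤ[T;T⁻¹] :=
  (((AddMonoidHom.mulLeft (LaurentPolynomial.T a : ℤ[T;T⁻¹])).comp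
    (Polynomial.toLaurent : Polynomial ℤ →+* ℤ[T;T⁻¹]).toAddMonoidHom)).range

theorem mem_ordGE {a : ℤ} {f : ℤ[T;T⁻¹]} :
    f ∈ ordGE a ↔ ∃ p : Polynomial ℤ, f = LaurentPolynomial.T a * Polynomial.toLaurent p :=
  exists_congr fun _ => eq_comm

theorem T_mem_ordGE {a e : ℤ} (h : a ≤ e) : LaurentPolynomial.T e ∈ ordGE a := by
  obtain ⟨n, rfl⟩ := Int.le.dest h
  exact mem_ordGE.2 ⟨Polynomial.X ^ n, by rw [Polynomial.toLaurent_X_pow, LaurentPolynomial.T_add]⟩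

theorem mul_mem_ordGE {a b : ℤ} {f g : ℤ[T;T⁻¹]} (hf : f ∈ ordGE a) (hg : g ∈ ordGE b) :
    f * g ∈ ordGE (a + b) := by
  obtain ⟨p, rfl⟩ := mem_ordGE.1 hf
  obtain ⟨r, rfl⟩ := mem_ordGE.1 hg
  exact mem_ordGE.2 ⟨p * r, by rw [map_mul, LaurentPolynomial.T_add]; ring⟩

theorem ordGE_anti {a b : ℤ} (h : a ≤ b) : ordGE b ≤ ordGE a := by
  intro f hf
  obtain ⟨p, rfl⟩ := mem_ordGE.1 hf
  have h1 := mul_mem_ordGE (T_mem_ordGE h) (mem_ordGE.2 ⟨p, by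
    rw [LaurentPolynomial.T_zero, one_mul]⟩ : Polynomial.toLaurent p ∈ ordGE 0)
  rwa [add_zero] at h1

theorem exists_mem_ordGE (f : ℤ[T;T⁻¹]) : ∃ n : ℕ, f ∈ ordGE (-n) := by
  obtain ⟨n, p, hp⟩ := LaurentPolynomial.exists_T_pow f
  refine ⟨n, mem_ordGE.2 ⟨p, ?_⟩⟩
  rw [hp, mul_comm, mul_assoc, ← LaurentPolynomial.T_add, add_neg_cancel,
    LaurentPolynomial.T_zero, mul_one]

theorem coeff_eq_zero_of_mem_ordGE {a n : ℤ} {f : ℤ[T;T⁻¹]} (hf : f ∈ ordGE a) (h : n < a) :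
    f.coeff n = 0 := by
  obtain ⟨p, rfl⟩ := mem_ordGE.1 hf
  induction p using Polynomial.induction_on' with
  | add p r hp hr =>
    rw [map_add, mul_add, AddMonoidAlgebra.coeff_add, Finsupp.add_apply,
      hp (mem_ordGE.2 ⟨p, rfl⟩), hr (mem_ordGE.2 ⟨r, rfl⟩), add_zero]
  | monomial k c =>
    rw [← Polynomial.C_mul_X_pow_eq_monomial, Polynomial.toLaurent_C_mul_X_pow,
      mul_left_comm, ← LaurentPolynomial.T_add, ← LaurentPolynomial.single_eq_C_mul_T,
      AddMonoidAlgebra.coeff_single, Finsupp.single_apply, if_neg (by omega)]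

theorem eq_zero_of_mem_barFixed_of_mem_ordGE {f : ℤ[T;T⁻¹]} (h : f ∈ barFixed)
    (hf : f ∈ ordGE 1) : f = 0 := by
  refine LaurentPolynomial.ext fun n => ?_
  rcases lt_or_ge n 1 with hn | hn
  · exact coeff_eq_zero_of_mem_ordGE hf hn
  · rw [← mem_barFixed.1 h, LaurentPolynomial.invert_apply]
    exact coeff_eq_zero_of_mem_ordGE hf (by omega)

/-- In a matrix `D` congruent to the identity modulo `q ℤ[q]`, the product `D c` is divisible by
no higher power of `q` than `c`. -/
theorem mem_ordGE_of_sum_mem {ι : Type*} [DecidableEq ι] (D : ι → ι → ℤ[T;T⁻¹])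
    (hD : ∀ i j, D i j - (if i = j then 1 else 0) ∈ ordGE 1) (c : ι →₀ ℤ[T;T⁻¹]) (d : ℤ)
    (h : ∀ i, (c.sum fun j a => a * D i j) ∈ ordGE d) (i : ι) : c i ∈ ordGE d := by
  have step : ∀ N : ℤ, N < d → (∀ i, c i ∈ ordGE N) → ∀ i, c i ∈ ordGE (N + 1) := by
    intro N hN hc i
    have h1 : c i = (c.sum fun j a => a * D i j) -
        c.sum fun j a => a * (D i j - if i = j then 1 else 0) := by
      rw [← Finsupp.sum_sub]
      simp only [mul_sub, sub_sub_cancel, mul_ite, mul_one, mul_zero]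
      rw [Finsupp.sum_ite_eq]
      simp only [Finsupp.mem_support_iff, ne_eq, ite_not]
      split <;> simp_all
    rw [h1]
    exact sub_mem (ordGE_anti (by omega) (h i))
      (sum_mem fun j _ => mul_mem_ordGE (hc j) (hD i j))
  obtain ⟨n, hn⟩ : ∃ n : ℕ, ∀ i, c i ∈ ordGE (-n) := by
    choose n hn using fun i => exists_mem_ordGE (c i)
    refine ⟨c.support.sup n, fun i => ?_⟩
    by_cases hi : i ∈ c.support
    · have := Finset.le_sup (f := n) hi
      exact ordGE_anti (by omega) (hn i)
    · rw [Finsupp.notMem_support_iff.1 hi]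
      exact zero_mem _
  have key : ∀ k : ℕ, -(n : ℤ) + k ≤ d → ∀ i, c i ∈ ordGE (-n + k) := by
    intro k
    induction k with
    | zero => intro _; simpa using hn
    | succ k ih =>
      intro hk
      have := step _ (by push_cast at hk; omega) (ih (by push_cast at hk; omega))
      rwa [add_assoc] at this
  rcases le_or_gt d (-n) with hd | hd
  · exact ordGE_anti hd (hn i)
  · have := key (d + n).toNat (by omega) i
    rwa [show -(n : ℤ) + (d + n).toNat = d by omega] at this

/-- The coefficient at a partition which is not zero in the truncated Fock space. -/
noncomputable def coefAt {l : YoungDiagram} (h : l ∈ ptn l.card 4) :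
    TruncFock 4 →ₗ[ℤ[T;T⁻¹]] ℤ[T;T⁻¹] :=
  (fockGT 4).liftQ (Finsupp.lapply l) <| by
    rw [fockGT, Submodule.span_le]
    rintro _ ⟨m, hm, rfl⟩
    refine Finsupp.single_eq_of_ne ?_
    rintro rfl
    exact hm h

theorem coefAt_proj {l : YoungDiagram} (h : l ∈ ptn l.card 4) (x : Fock) :
    coefAt h (proj 4 x) = x l := rfl

theorem basis_form_small : ∀ n < 13, ∀ C ∈ basis n, C.head? = some (0, label C) ∧
    (∀ x ∈ C.tail, 1 ≤ x.1) ∧ (label C).sum = n ∧ n ≤ (label C).headD 0 + 4 ∧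
    ((label C) = [] → n = 0) ∧ ∀ D ∈ basis n, label C = label D → C = D := by
  decide +kernel

theorem shiftRow_injective (s : ℕ) : Function.Injective (shiftRow s) := by
  intro v w h
  cases v <;> cases w <;> simp_all [shiftRow]

/-- The shape of the members of `basis n`. -/
theorem basis_form {n : ℕ} {C : Terms} (hC : C ∈ basis n) :
    C = (0, label C) :: C.tail ∧ (∀ x ∈ C.tail, 1 ≤ x.1) ∧ IsRows (label C) ∧
      (label C).sum = n ∧ n ≤ (label C).headD 0 + 4 ∧
      ∀ D ∈ basis n, label C = label D → C = D := by
  obtain ⟨m, s, rfl, hm, hs⟩ := exists_eq_add n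
  have hb := basis_add (n := m) (s := s) (hs.imp id (by omega))
  rw [hb, List.mem_map] at hC
  obtain ⟨C, hC, rfl⟩ := hC
  have hlab : ∀ D ∈ basis m, label (shiftTerms s D) = shiftRow s (label D) := by
    intro D hD
    have := (basis_form_small m hm D hD).1
    cases D with
    | nil => simp at this
    | cons x D => rfl
  obtain ⟨h1, h2, h3, h4, h5, h6⟩ := basis_form_small m hm C hC
  rw [hlab C hC]
  cases C with
  | nil => simp at h1
  | cons x C =>
    rw [List.head?_cons, Option.some_inj] at h1
    have hst := isStable_basis hm hs hC (List.mem_cons_self : x ∈ x :: C)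
    rw [h1] at hst
    refine ⟨?_, ?_, hst.isRows, ?_, ?_, ?_⟩
    · rw [shiftTerms, List.map_cons, List.tail_cons, h1]
      rfl
    · intro y hy
      rw [shiftTerms, List.map_cons, List.tail_cons, List.mem_map] at hy
      obtain ⟨y, hy, rfl⟩ := hy
      exact h2 y hy
    · rcases hl : label (x :: C) with _ | ⟨a, t⟩
      · have := h5 hl
        simp only [shiftRow, List.sum_nil]
        omega
      · rw [hl] at h3
        simp only [shiftRow, List.sum_cons] at h3 ⊢
        omega
    · rcases hl : label (x :: C) with _ | ⟨a, t⟩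
      · have := h5 hl
        omega
      · rw [hl] at h4
        simp only [shiftRow, List.headD_cons] at h4 ⊢
        omega
    · intro D hD h
      rw [hb, List.mem_map] at hD
      obtain ⟨D, hD, rfl⟩ := hD
      rw [hlab D hD] at h
      rw [h6 D hD (shiftRow_injective s h)]

theorem ofRows_injOn {v w : List ℕ} (hv : IsRows v) (hw : IsRows w) (h : ofRows v = ofRows w) :
    v = w := by
  rw [← rowLens_ofRows hv, h, rowLens_ofRows hw]

theorem ofRows_mem_ptn {w : List ℕ} (hw : IsRows w) (h : w.sum ≤ w.headD 0 + 4) :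
    ofRows w ∈ ptn (ofRows w).card 4 := by
  rwa [mem_ptn_card, rowLens_ofRows hw]

/-- The basis vectors in all degrees. -/
abbrev BasisVec : Type := {C : Terms // ∃ n, C ∈ basis n}

theorem BasisVec.mem_ptn (C : BasisVec) :
    ofRows (label C.1) ∈ ptn (ofRows (label C.1)).card 4 := by
  obtain ⟨C, n, hC⟩ := C
  obtain ⟨-, -, h, h1, h2, -⟩ := basis_form hC
  exact ofRows_mem_ptn h (h1.trans_le h2)

theorem tval_mem_ordGE {P : List ℕ → ℤ[T;T⁻¹]} (hP : ∀ w, P w ∈ ordGE 0) {v : Terms}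
    (hv : ∀ x ∈ v, 1 ≤ x.1) : tval P v ∈ ordGE 1 := by
  refine list_sum_mem fun f hf => ?_
  obtain ⟨x, hx, rfl⟩ := List.mem_map.1 hf
  have h := mul_mem_ordGE (T_mem_ordGE (hv x hx)) (hP x.2)
  rwa [add_zero] at h

open Classical in
theorem coefAt_pvec {l : YoungDiagram} (h : l ∈ ptn l.card 4) (w : List ℕ) :
    coefAt h (pvec w) = if ofRows w = l then 1 else 0 := by
  rw [pvec, coefAt_proj, vec, Finsupp.single_apply]

/-- The coefficients of the basis vectors at the labels form the identity matrix modulo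
`q ℤ[q]`. -/
theorem coefAt_basis (C D : BasisVec) :
    coefAt C.mem_ptn (tval pvec D.1) - (if C = D then 1 else 0) ∈ ordGE 1 := by
  classical
  obtain ⟨h1, h2, h3, h4, -, h6⟩ := basis_form D.2.choose_spec
  rw [h1, tval_cons, map_add, map_smul, coefAt_pvec, LaurentPolynomial.T_zero, one_smul, map_tval]
  have hiff : ofRows (label D.1) = ofRows (label C.1) ↔ C = D := by
    constructor
    · intro h
      obtain ⟨-, -, h3', h4', -, -⟩ := basis_form C.2.choose_spec
      have h := ofRows_injOn h3 h3' h
      refine Subtype.ext (h6 C.1 ?_ h).symm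
      rw [← h4, h, h4']
      exact C.2.choose_spec
    · rintro rfl
      rfl
  simp only [hiff, add_sub_cancel_left]
  refine tval_mem_ordGE (fun w => ?_) h2
  rw [Function.comp_apply, coefAt_pvec]
  split
  · exact T_mem_ordGE (e := 0) le_rfl
  · exact zero_mem _

/-- The combination of basis vectors with given coefficients. -/
noncomputable def basisComb : (BasisVec →₀ ℤ[T;T⁻¹]) →ₗ[ℤ[T;T⁻¹]] TruncFock 4 :=
  Finsupp.linearCombination ℤ[T;T⁻¹] fun C => tval pvec C.1

theorem mem_ordGE_of_basisComb {c : BasisVec →₀ ℤ[T;T⁻¹]} {d : ℤ}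
    (h : ∀ (l : YoungDiagram) (hl : l ∈ ptn l.card 4), coefAt hl (basisComb c) ∈ ordGE d)
    (C : BasisVec) : c C ∈ ordGE d := by
  refine mem_ordGE_of_sum_mem _ coefAt_basis c d (fun D => ?_) C
  have := h _ D.mem_ptn
  rw [basisComb, Finsupp.linearCombination_apply, map_finsuppSum] at this
  simpa only [map_smul, smul_eq_mul] using this

theorem basisComb_injective : Function.Injective basisComb := by
  rw [injective_iff_map_eq_zero]
  intro c hc
  ext C n
  refine coeff_eq_zero_of_mem_ordGE (a := n + 1) (mem_ordGE_of_basisComb (fun l hl => ?_) C)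
    (by omega)
  rw [hc, map_zero]
  exact zero_mem _

/-- The images of words have bar invariant coefficients. -/
theorem exists_basisComb_eq (w : List (ZMod 3 × ℕ)) :
    ∃ c : BasisVec →₀ ℤ[T;T⁻¹], (∀ C, c C ∈ barFixed) ∧
      basisComb c = proj 4 (applyWord 3 w) := by
  have h := applyWord_mem_basisLattice w
  have himg : tval pvec '' {C | ∃ n, C ∈ basis n} =
      Set.range fun C : BasisVec => tval pvec C.1 := by
    rw [← Set.image_univ]
    ext y
    simp
  rw [basisLattice, himg, Finsupp.mem_span_range_iff_exists_finsupp] at h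
  obtain ⟨c, hc⟩ := h
  refine ⟨c.mapRange Subtype.val rfl, fun C => (c C).2, ?_⟩
  rw [← hc, basisComb, Finsupp.linearCombination_apply, Finsupp.sum_mapRange_index]
  · rfl
  · simp

/-- An element of the truncation of `L` whose coefficients are in `q ℤ[q]`
and which is bar invariant is zero. -/
theorem eq_zero_of_bar_of_mem_ordGE (u : Words 3)
    (hbar : proj 4 (act 3 (bar u)) = proj 4 (act 3 u))
    (h : ∀ (l : YoungDiagram) (hl : l ∈ ptn l.card 4), coefAt hl (proj 4 (act 3 u)) ∈ ordGE 1) :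
    proj 4 (act 3 u) = 0 := by
  choose c hc hcw using exists_basisComb_eq
  -- lift the action of words along `basisComb`
  let Ψ : Words 3 →ₗ[ℤ[T;T⁻¹]] BasisVec →₀ ℤ[T;T⁻¹] := Finsupp.linearCombination _ c
  have hΨ : ∀ u, proj 4 (act 3 u) = basisComb (Ψ u) := by
    intro u
    rw [act, Finsupp.linearCombination_apply, map_finsuppSum, Finsupp.linearCombination_apply,
      map_finsuppSum]
    simp only [map_smul, hcw]
  have hΨbar : ∀ u C, Ψ (bar u) C = LaurentPolynomial.invert (Ψ u C) := by
    intro u C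
    simp only [Ψ]
    rw [bar, Finsupp.linearCombination_apply, Finsupp.linearCombination_apply,
      Finsupp.sum_mapRange_index (by simp), Finsupp.sum, Finsupp.sum, Finsupp.finsetSum_apply,
      Finsupp.finsetSum_apply, map_sum]
    refine Finset.sum_congr rfl fun w _ => ?_
    rw [Finsupp.smul_apply, Finsupp.smul_apply, smul_eq_mul, smul_eq_mul, map_mul,
      mem_barFixed.1 (hc w C)]
  rw [hΨ, hΨ] at hbar
  have hfix := basisComb_injective hbar
  rw [hΨ] at h ⊢
  have : Ψ u = 0 := by
    ext1 C
    refine eq_zero_of_mem_barFixed_of_mem_ordGE ?_ (mem_ordGE_of_basisComb h C)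
    rw [mem_barFixed, ← hΨbar, hfix]
  rw [this, map_zero]

theorem isTruncCrystal_unique {μ : YoungDiagram} {y z : TruncFock 4}
    (hy : IsTruncCrystal 3 4 μ y) (hz : IsTruncCrystal 3 4 μ z) : y = z := by
  obtain ⟨⟨u, hu, hu'⟩, x, hx, hyx⟩ := hy
  obtain ⟨⟨v, hv, hv'⟩, x', hx', hzx⟩ := hz
  have hbar : bar (u - v) = bar u - bar v := Finsupp.mapRange_sub (map_sub _) u v
  have h1 : proj 4 (act 3 (u - v)) = y - z := by rw [map_sub, map_sub, hu, hv]
  have h2 : y - z = proj 4 (x - x') := by rw [map_sub, ← hyx, ← hzx, sub_sub_sub_cancel_right]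
  have h := eq_zero_of_bar_of_mem_ordGE (u - v)
    (by rw [hbar, h1, map_sub, map_sub, hu', hv']) fun l hl => by
      rw [h1, h2, coefAt_proj, Finsupp.sub_apply]
      exact sub_mem (mem_ordGE.2 (hx l)) (mem_ordGE.2 (hx' l))
  rwa [h1, sub_eq_zero] at h

/-! ### Existence -/

theorem isTruncCrystal_basis {n : ℕ} {C : Terms} (hC : C ∈ basis n) :
    IsTruncCrystal 3 4 (ofRows (label C)) (tval pvec C) := by
  constructor
  · have h := basis_mem_wordLattice n hC
    rw [wordLattice, Finsupp.mem_span_range_iff_exists_finsupp] at h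
    obtain ⟨c, hc⟩ := h
    refine ⟨c.mapRange Subtype.val rfl, ?_, ?_⟩
    · rw [← hc, act, Finsupp.linearCombination_apply, map_finsuppSum,
        Finsupp.sum_mapRange_index (by simp)]
      simp only [map_smul]
      rfl
    · have hb : bar (c.mapRange Subtype.val rfl) = c.mapRange Subtype.val rfl := by
        ext1 w
        exact (c w).2
      rw [hb, ← hc, act, Finsupp.linearCombination_apply, map_finsuppSum,
        Finsupp.sum_mapRange_index (by simp)]
      simp only [map_smul]
      rfl
  · obtain ⟨h1, h2, -⟩ := basis_form hC
    refine ⟨tval (fun w => vec (ofRows w)) C.tail, fun l => mem_ordGE.1 ?_, ?_⟩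
    · classical
      rw [← Finsupp.lapply_apply (R := ℤ[T;T⁻¹]), map_tval]
      refine tval_mem_ordGE (fun w => ?_) h2
      rw [Function.comp_apply, Finsupp.lapply_apply, vec, Finsupp.single_apply]
      split
      · exact T_mem_ordGE (e := 0) le_rfl
      · exact zero_mem _
    · conv_lhs => rw [h1]
      rw [tval_cons, LaurentPolynomial.T_zero, one_smul, map_tval]
      exact add_sub_cancel_left _ _

/-! ### The table -/

theorem sum_table_smul {M : Type*} [AddCommGroup M] [Module ℤ[T;T⁻¹] M] (X : List ℕ → M)
    (j : Fin 10) {r : ℕ} (hr : r < 3) :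
    ∑ i : Fin 12, table (r : ZMod 3) i j • X (rowTail i) =
      (((colData j).filter fun x => r ∈ x.2.1).map fun x =>
        (LaurentPolynomial.T (x.1 : ℤ) : ℤ[T;T⁻¹]) • X x.2.2).sum := by
  have h01 : (0 : ZMod 3) ≠ 1 := by decide
  have h02 : (0 : ZMod 3) ≠ 2 := by decide
  have h12 : (1 : ZMod 3) ≠ 2 := by decide
  interval_cases r <;> fin_cases j <;>
    simp [Fin.sum_univ_succ, table, δ, rowTail, colData, h01, h02, h12, h01.symm, h02.symm,
      h12.symm, q]

theorem column_eq (n : ℕ) (j : Fin 10) : column n j = tval pvec (colTerms n j) := by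
  have h := sum_table_smul (fun t => pvec ((n - t.sum) :: t)) j (Nat.mod_lt n (by norm_num))
  rw [ZMod.natCast_mod] at h
  rw [column, map_sum, tval, colTerms, List.map_map]
  simp only [map_smul]
  exact h

theorem colTerms_mem_basis {n : ℕ} {j : Fin 10} (h : bound j ≤ n) : colTerms n j ∈ basis n := by
  refine List.mem_append_right _ (List.mem_map_of_mem ?_)
  simpa using h

theorem label_colTerms (n : ℕ) (j : Fin 10) :
    label (colTerms n j) = (n - (colTail j).sum) :: colTail j := by
  have h : ∀ r < 3, ∀ j, ((colData j).filter fun x => r ∈ x.2.1).head? =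
      some (0, [0, 1, 2], colTail j) := by
    decide
  have h := h (n % 3) (Nat.mod_lt n (by norm_num)) j
  obtain ⟨t, ht⟩ := List.head?_eq_some_iff.1 h
  rw [colTerms, ht]
  rfl

theorem isRows_colTail {n : ℕ} {j : Fin 10} (h : bound j ≤ n) :
    IsRows ((n - (colTail j).sum) :: colTail j) := by
  rw [← label_colTerms]
  exact (basis_form (colTerms_mem_basis h)).2.2.1

/-- A part that occurs twice in the tail is smaller than the first part, by the choice of
`bound`. -/
theorem isRegular_colTail {n : ℕ} {j : Fin 10} (h : bound j ≤ n) :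
    IsRegular 3 (withTail n (colTail j)) := by
  have hc : ∀ j, (∀ a ∈ colTail j, (colTail j).count a < 3) ∧
      ∀ a ∈ colTail j, 2 ≤ (colTail j).count a → a + (colTail j).sum < bound j := by
    decide
  obtain ⟨h1, h2⟩ := hc j
  intro a _
  change (ofRows _).rowLens.count a < 3
  rw [rowLens_ofRows (isRows_colTail h), List.count_cons]
  by_cases ha : a ∈ colTail j
  · have h1 := h1 a ha
    have h2 := h2 a ha
    split
    · rename_i he
      rw [beq_iff_eq] at he
      omega
    · exact h1
  · rw [List.count_eq_zero_of_not_mem ha]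
    split <;> omega

theorem isTruncCrystal_iff {n : ℕ} {j : Fin 10} (h : bound j ≤ n) (y : TruncFock 4) :
    IsTruncCrystal 3 4 (withTail n (colTail j)) y ↔ y = column n j := by
  have hc : IsTruncCrystal 3 4 (withTail n (colTail j)) (column n j) := by
    have := isTruncCrystal_basis (colTerms_mem_basis h)
    rwa [label_colTerms, ← column_eq] at this
  constructor
  · exact fun hy => isTruncCrystal_unique hy hc
  · rintro rfl
    exact hc

theorem proj_globalCrystalBasis {n : ℕ} {j : Fin 10} (h : bound j ≤ n) {B : Reg 3 → Fock}
    (hB : IsGlobalCrystalBasis 3 B) (hμ : IsRegular 3 (withTail n (colTail j))) :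
    proj 4 (B ⟨withTail n (colTail j), hμ⟩) = column n j := by
  rw [← isTruncCrystal_iff h]
  obtain ⟨u, hu, hu'⟩ := hB.bar_eq ⟨_, hμ⟩
  exact ⟨⟨u, congrArg _ hu, congrArg _ hu'⟩, _, hB.congr_q ⟨_, hμ⟩, (map_sub _ _ _).symm⟩

/-! ### The rows and columns of the decomposition matrix -/

theorem exists_rowTail_eq {t : List ℕ} (ht : IsRows t) (h : t.sum ≤ 4) :
    ∃ i, rowTail i = t := by
  obtain ⟨h1, h2⟩ := ht
  rw [List.sortedGE_iff_pairwise] at h1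
  match t with
  | [] => exact ⟨0, rfl⟩
  | [a] =>
    simp at h1 h2 h
    interval_cases a <;> decide
  | [a, b] =>
    simp at h1 h2 h
    have : a ≤ 3 := by omega
    have : b ≤ 3 := by omega
    obtain ⟨_, _⟩ := h2
    interval_cases a <;> interval_cases b <;> first | omega | decide
  | [a, b, c] =>
    simp at h1 h2 h
    have : a ≤ 2 := by omega
    have : b = 1 := by omega
    have : c = 1 := by omega
    obtain ⟨_, _⟩ := h2
    subst b c
    interval_cases a <;> decide
  | [a, b, c, d] =>
    simp at h1 h2 h
    obtain ⟨rfl, rfl, rfl, rfl⟩ : a = 1 ∧ b = 1 ∧ c = 1 ∧ d = 1 := by omega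
    decide
  | a :: b :: c :: d :: e :: t =>
    simp at h2 h
    omega

theorem isRows_rowTail {n : ℕ} (hn : 8 ≤ n) (i : Fin 12) :
    IsRows ((n - (rowTail i).sum) :: rowTail i) := by
  have h : ∀ i, (rowTail i).IsChain (· ≥ ·) ∧ (rowTail i).sum ≤ 4 ∧
      ∀ x ∈ rowTail i, 0 < x ∧ x ≤ 4 := by
    decide
  obtain ⟨h1, h2, h3⟩ := h i
  refine ⟨?_, fun x hx => ?_⟩
  · rw [List.sortedGE_iff_pairwise, List.pairwise_cons]
    exact ⟨fun x hx => by have := h3 x hx; omega, h1.sortedGE.pairwise⟩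
  · rcases List.mem_cons.1 hx with rfl | hx
    · omega
    · exact (h3 x hx).1

theorem sum_rowTail_le (i : Fin 12) : (rowTail i).sum ≤ 4 := by
  revert i
  decide

theorem mem_ptn_iff {n : ℕ} {l : YoungDiagram} :
    l ∈ ptn n 4 ↔ l.rowLens.sum = n ∧ n ≤ l.rowLens.headD 0 + 4 := by
  rw [sum_rowLens, headD_rowLens]
  rfl

theorem rowLens_withTail {n : ℕ} (hn : 8 ≤ n) (i : Fin 12) :
    (withTail n (rowTail i)).rowLens = (n - (rowTail i).sum) :: rowTail i :=
  rowLens_ofRows (isRows_rowTail hn i)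

theorem withTail_mem_ptn {n : ℕ} (hn : 8 ≤ n) (i : Fin 12) :
    withTail n (rowTail i) ∈ ptn n 4 := by
  have := sum_rowTail_le i
  rw [mem_ptn_iff, rowLens_withTail hn, List.sum_cons, List.headD_cons]
  omega

theorem withTail_injective {n : ℕ} (hn : 8 ≤ n) :
    Function.Injective fun i => withTail n (rowTail i) := by
  have h : Function.Injective rowTail := by decide
  intro i j hij
  have := congrArg YoungDiagram.rowLens hij
  simp only [rowLens_withTail hn, List.cons.injEq] at this
  exact h this.2

theorem exists_withTail_eq {n : ℕ} (hn : 8 ≤ n) {l : YoungDiagram} (hl : l ∈ ptn n 4) :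
    ∃ i, withTail n (rowTail i) = l := by
  obtain ⟨h1, h2⟩ := mem_ptn_iff.1 hl
  rcases hw : l.rowLens with _ | ⟨m, t⟩
  · rw [hw, List.sum_nil] at h1
    omega
  · rw [hw, List.sum_cons] at h1
    rw [hw, List.headD_cons] at h2
    have ht : IsRows t := by
      refine ⟨?_, fun x hx => l.pos_of_mem_rowLens x (hw ▸ List.mem_cons_of_mem _ hx)⟩
      have := l.rowLens_sorted
      rw [hw, List.sortedGE_iff_pairwise, List.pairwise_cons] at this
      exact this.2.sortedGE
    obtain ⟨i, rfl⟩ := exists_rowTail_eq ht (by omega)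
    refine ⟨i, ?_⟩
    rw [← ofRows_rowLens l, hw]
    change ofRows ((n - (rowTail i).sum) :: rowTail i) = _
    rw [show n - (rowTail i).sum = m by omega]

/-- The tails of the regular partitions among those of the rows. -/
def colRow : Fin 10 → Fin 12 := ![0, 1, 2, 3, 4, 5, 7, 8, 9, 10]

theorem rowTail_colRow (j : Fin 10) : rowTail (colRow j) = colTail j := by
  revert j
  decide

theorem bound_le (j : Fin 10) : bound j ≤ 8 := by
  revert j
  decide

theorem exists_colRow_eq {n : ℕ} (hn : 8 ≤ n) {i : Fin 12}
    (h : IsRegular 3 (withTail n (rowTail i))) : ∃ j, colRow j = i := by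
  have hc : ∀ i, (∃ j, colRow j = i) ∨ 3 ≤ (rowTail i).count 1 := by decide
  refine (hc i).resolve_right fun h3 => ?_
  have h1 := h 1
  rw [rowLens_withTail hn] at h1
  have h2 := h1 (List.mem_cons_of_mem _ (List.count_pos_iff.1 (by omega)))
  have h4 := List.count_le_count_cons (a := 1) (b := n - (rowTail i).sum) (l := rowTail i)
  omega

/-- The reversed lexicographical order compares the sums of the tails first. -/
theorem withTail_lt {n : ℕ} (hn : 8 ≤ n) {i i' : Fin 12} (h : i < i') :
    (withTail n (rowTail i')).rowLens < (withTail n (rowTail i)).rowLens := by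
  have hc : ∀ i i', i < i' → (rowTail i).sum < (rowTail i').sum ∨
      (rowTail i).sum = (rowTail i').sum ∧ rowTail i' < rowTail i := by
    decide
  rw [rowLens_withTail hn, rowLens_withTail hn, List.cons_lt_cons_iff]
  have := sum_rowTail_le i'
  rcases hc i i' h with h | ⟨h, h'⟩
  · left
    omega
  · right
    exact ⟨by rw [h], h'⟩

end LLT

open LLT
theorem mainTheorem10 :
    -- the elements of the global crystal basis in the truncated Fock space, generically in `n`
    (∀ (j : Fin 10) (n : ℕ), bound j ≤ n →
      ∃ hμ : IsRegular 3 (withTail n (colTail j)),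
        -- the column is the only bar invariant element of the truncation congruent to `μ`
        (∀ y : TruncFock 4,
          IsTruncCrystal 3 4 (withTail n (colTail j)) y ↔ y = column n j) ∧
        -- it is the projection of the member of the global crystal basis labelled by `μ`
        (∀ B : Reg 3 → Fock, IsGlobalCrystalBasis 3 B →
          proj 4 (B ⟨withTail n (colTail j), hμ⟩) = column n j)) ∧
    -- the crystallized decomposition matrix for `n ≥ 8`
    (∀ n : ℕ, 8 ≤ n →
      ∃ (e : Fin 12 ≃ {l : YoungDiagram // l ∈ ptn n 4})
        (f : Fin 10 ≃ {μ : Reg 3 // μ.1 ∈ ptn n 4}),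
        (∀ i, (e i).1 = withTail n (rowTail i)) ∧
        (∀ j, (f j).1.1 = withTail n (colTail j)) ∧
        -- the ordering is the reversed lexicographical one
        (∀ i i' : Fin 12, i < i' → (e i').1.rowLens < (e i).1.rowLens) ∧
        (∀ j j' : Fin 10, j < j' → (f j').1.1.rowLens < (f j).1.1.rowLens) ∧
        (∀ B : Reg 3 → Fock, IsGlobalCrystalBasis 3 B →
          (crystDecMatrix B n 4).submatrix e f = table (n : ZMod 3))) := by
  refine ⟨fun j n hn => ⟨isRegular_colTail hn, isTruncCrystal_iff hn,
    fun B hB => proj_globalCrystalBasis hn hB _⟩, fun n hn => ?_⟩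
  have hb : ∀ j, bound j ≤ n := fun j => (bound_le j).trans hn
  have hmono : StrictMono colRow := by
    intro j j'
    revert j j'
    decide
  have hcol : ∀ j, withTail n (colTail j) ∈ ptn n 4 := fun j => by
    rw [← rowTail_colRow]
    exact withTail_mem_ptn hn _
  let e : Fin 12 ≃ {l : YoungDiagram // l ∈ ptn n 4} :=
    Equiv.ofBijective (fun i => ⟨withTail n (rowTail i), withTail_mem_ptn hn i⟩)
      ⟨fun i i' h => withTail_injective hn (congrArg Subtype.val h), fun l => by
        obtain ⟨i, hi⟩ := exists_withTail_eq hn l.2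
        exact ⟨i, Subtype.ext hi⟩⟩
  let f : Fin 10 ≃ {μ : Reg 3 // μ.1 ∈ ptn n 4} :=
    Equiv.ofBijective (fun j => ⟨⟨withTail n (colTail j), isRegular_colTail (hb j)⟩, hcol j⟩)
      ⟨fun j j' h => by
        have := congrArg (fun μ => μ.1.1) h
        simp only [← rowTail_colRow] at this
        exact hmono.injective (withTail_injective hn this), fun μ => by
        obtain ⟨i, hi⟩ := exists_withTail_eq hn μ.2
        obtain ⟨j, rfl⟩ := exists_colRow_eq hn (hi ▸ μ.1.2)
        exact ⟨j, Subtype.ext (Subtype.ext (by rw [← hi, rowTail_colRow]))⟩⟩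
  have hf : ∀ j, (f j).1.1 = withTail n (rowTail (colRow j)) := fun j => by
    rw [rowTail_colRow]
    rfl
  refine ⟨e, f, fun _ => rfl, fun _ => rfl, fun i i' h => withTail_lt hn h, fun j j' h => ?_,
    fun B hB => ?_⟩
  · rw [hf, hf]
    exact withTail_lt hn (hmono h)
  · ext1 i j
    classical
    have hm := withTail_mem_ptn hn i
    have hl : withTail n (rowTail i) ∈ ptn (withTail n (rowTail i)).card 4 :=
      ⟨rfl, hm.1.trans_le hm.2⟩
    have h := congrArg (coefAt hl)
      (proj_globalCrystalBasis (hb j) hB (isRegular_colTail (hb j)))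
    rw [coefAt_proj, column, coefAt_proj, Finsupp.finsetSum_apply,
      Finset.sum_eq_single i] at h
    · refine h.trans ?_
      rw [Finsupp.smul_apply, vec, Finsupp.single_eq_same, smul_eq_mul, mul_one]
    · intro i' _ hi'
      rw [Finsupp.smul_apply, vec, Finsupp.single_eq_of_ne, smul_zero]
      exact fun he => hi' (withTail_injective hn he).symm
    · exact fun hi => absurd (Finset.mem_univ _) hi
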